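/- Consider the repeated game with states $\omega_1,\omega_2$ and receiver actions $a_1,\dots,a_4$, in which the pairs $(u_S,u_R)$ of stage payoffs of the sender and of the receiver are $$ \begin{array}{c|cccc} & a_1&a_2&a_3&a_4\\ \hline \omega_1&(2,8)&(0,7)&(4,3)&(2,0)\\ \omega_2&(2,0)&(4,3)&(0,7)&(2,8)\end{array} $$ and the state follows the stationary Markov chain that keeps its current state with probability $4/5$ (law $\mu$). In each period the sender, who knows $\mu$, announces a forecast $f\in\Delta\{\omega_1,\omega_2\}$ as a (possibly random) function of the past forecasts and states; the receiver then takes an action; then the state is observed. A mean-based learner is a family of receiver algorithms, one for each horizon $T$, such that for some $\gamma(T)\to0$: in the $T$-period game, at every history and for every current forecast $f$, each action whose cumulative payoff against the past states of the periods with forecast $f$ is more than $\gamma(T)\,T$ below that of some other action is played with probability at most $\gamma(T)$. Let $\hat u_S(q)$ be the sender's expected stage payoff when the state has law $q$ and the receiver takes an action that is optimal for $q$ (ties broken in favor of the sender). Let $C_\mu$ be the distribution of conditionals, that is, $C_\mu(p)$ is the almost sure long-run frequency of the periods $t$ with $\mu(\omega_t=\cdot\mid\omega_1,\dots,\omega_{t-1})=p$.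 Let $\mathrm{Per}(C_\mu,\hat u_S)$ be the maximum of $\mathbb E_Q[\hat u_S]$ over all mean-preserving contractions $Q$ of $C_\mu$, i.e. over all weak limits of distributions obtained from $C_\mu$ by merging fractions of its atoms at their barycenters. Then $C_\mu$ exists and puts mass $1/2$ on each of the two conditionals $\mathbb P(\omega_2)=1/5$ and $\mathbb P(\omega_2)=4/5$; $\mathrm{Per}(C_\mu,\hat u_S)=2$; and the sender can guarantee $$V=\tfrac{28}{11}>2=\mathrm{Per}(C_\mu,\hat u_S)$$ against a mean-based learner: there are forecasting strategies $(\sigma_T)_{T}$ such that against every mean-based learner and for every $\varepsilon>0$, her average payoff in the $T$-period game is at least $V-\varepsilon$ in expectation for all large $T$, and with probability tending to $1$ as $T\to\infty$. -/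

import Mathlib

open MeasureTheory ProbabilityTheory Filter Topology

noncomputable section

namespace Forecasting

/-! ### The law of a Markov chain -/

section MarkovChain

variable {Ω : Type*} [Fintype Ω] [MeasurableSpace Ω]

/-- The measure on the finite set `Ω` with weights `p`. -/
def weightMeasure (p : stdSimplex ℝ Ω) : Measure Ω :=
  ∑ x, ENNReal.ofReal (p x) • Measure.dirac x

instance (p : stdSimplex ℝ Ω) : IsProbabilityMeasure (weightMeasure p) := by
  constructor
  have h : ∑ x, ENNReal.ofReal (p x) = 1 := by
    have h1 : ∑ x, p x = 1 := p.2.2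
    rw [← ENNReal.ofReal_one, ← h1]
    exact (ENNReal.ofReal_sum_of_nonneg (fun x _ => p.2.1 x)).symm
  simpa [weightMeasure] using h

variable [DiscreteMeasurableSpace Ω]

/-- The transition kernel with transition probabilities `K x y` from `x` to `y`. -/
def transitionKernel (K : Ω → stdSimplex ℝ Ω) : Kernel Ω Ω where
  toFun x := weightMeasure (K x)
  measurable' := measurable_of_countable _

instance (K : Ω → stdSimplex ℝ Ω) : IsMarkovKernel (transitionKernel K) :=
  ⟨fun x => inferInstanceAs (IsProbabilityMeasure (weightMeasure (K x)))⟩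

/-- The same transition, read as a kernel from the path up to time `n` to the state at time
`n + 1`; it only looks at the state at time `n`. -/
def stepKernel (K : Ω → stdSimplex ℝ Ω) (n : ℕ) :
    Kernel (∀ _ : Finset.Iic n, Ω) Ω :=
  (transitionKernel K).comap (fun x => x ⟨n, Finset.mem_Iic.2 le_rfl⟩) (measurable_pi_apply _)

instance (K : Ω → stdSimplex ℝ Ω) (n : ℕ) : IsMarkovKernel (stepKernel K n) := by
  unfold stepKernel; infer_instance

/-- The law on `Ω^ℕ` of the Markov chain with initial distribution `p₀` and transition
probabilities `K`. -/
def markovLaw (p₀ : stdSimplex ℝ Ω) (K : Ω → stdSimplex ℝ Ω) : ProbabilityMeasure (ℕ → Ω) :=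
  ⟨Kernel.trajMeasure (X := fun _ => Ω) (weightMeasure p₀) (stepKernel K),
    by infer_instance⟩

end MarkovChain

/-! ### Repeated sender-receiver games -/

/-- A repeated forecasting game: stage payoffs of the sender and of the receiver, and the law of
the state process. Periods are numbered `0, 1, 2, …`. A forecast is an element of
`stdSimplex ℝ Ω`. -/
structure Game (Ω A : Type*) [MeasurableSpace Ω] where
  /-- the sender's payoff -/
  uS : Ω → A → ℝ
  /-- the receiver's payoff -/
  uR : Ω → A → ℝ
  /-- the law of the state process -/
  law : ProbabilityMeasure (ℕ → Ω)

/-- What happens in one period. -/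
structure Round (Ω A : Type*) [Fintype Ω] where
  /-- the forecast that the sender announces -/
  forecast : stdSimplex ℝ Ω
  /-- the action that the receiver takes -/
  action : A
  /-- the state that is then observed -/
  state : Ω

/-- A forecasting strategy: the (possibly random) forecast as a function of the past forecasts and
states, the most recent period first. -/
abbrev SenderStrategy (Ω : Type*) [Fintype Ω] : Type _ :=
  List (stdSimplex ℝ Ω × Ω) → PMF (stdSimplex ℝ Ω)

/-- A receiver's algorithm: the mixed action as a function of the past (most recent period first)
and of the current forecast. -/
abbrev ReceiverAlgorithm (Ω A : Type*) [Fintype Ω] : Type _ :=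
  List (Round Ω A) → stdSimplex ℝ Ω → PMF A

section Play

variable {Ω A : Type*} [Fintype Ω]

/-- The distribution of the first `t` rounds, given the path `ω` of states. The forecast and the
action of a period are drawn from the past only, so `ω t` is used after both are drawn. -/
def playLaw (σ : SenderStrategy Ω) (ρ : ReceiverAlgorithm Ω A) (ω : ℕ → Ω) :
    ℕ → PMF (List (Round Ω A))
  | 0 => PMF.pure []
  | t + 1 =>
    (playLaw σ ρ ω t).bind fun h =>
      (σ (h.map fun r => (r.forecast, r.state))).bind fun f =>
        (ρ h f).map fun a => ⟨f, a, ω t⟩ :: h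

open Classical in
/-- The cumulative payoff that the fixed action `a` would have given to the receiver in those past
periods in which the forecast was `f`. -/
def cumulativePayoff (uR : Ω → A → ℝ) (h : List (Round Ω A)) (f : stdSimplex ℝ Ω) (a : A) : ℝ :=
  ((h.filter fun r => r.forecast = f).map fun r => uR r.state a).sum

/-- An algorithm for the `T`-period game is `γ`-mean-based, forecast by forecast: an action whose
past cumulative payoff, on the periods with the current forecast, is more than `γ T` below that of
some other action is played with probability at most `γ`. -/
def IsMeanBasedWith (uR : Ω → A → ℝ) (γ : ℝ) (T : ℕ) (ρ : ReceiverAlgorithm Ω A) : Prop :=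
  ∀ h : List (Round Ω A), h.length < T → ∀ (f : stdSimplex ℝ Ω) (a : A),
    (∃ b : A, cumulativePayoff uR h f a < cumulativePayoff uR h f b - γ * T) →
      (ρ h f a).toReal ≤ γ

/-- A mean-based learner: one algorithm for each horizon `T`, which is `γ T`-mean-based for some
`γ = o(1)`. -/
def IsMeanBased (uR : Ω → A → ℝ) (ρ : ℕ → ReceiverAlgorithm Ω A) : Prop :=
  ∃ γ : ℕ → ℝ, Tendsto γ atTop (𝓝 0) ∧ ∀ T, IsMeanBasedWith uR (γ T) T (ρ T)

variable [MeasurableSpace Ω]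

namespace Game

variable (G : Game Ω A)

/-- The sender's average payoff along a finite history. -/
def averagePayoff (h : List (Round Ω A)) : ℝ :=
  (h.map fun r => G.uS r.state r.action).sum / h.length

/-- The expected value of the sender's average payoff over the first `T` periods. -/
def expectedPayoff (σ : SenderStrategy Ω) (ρ : ReceiverAlgorithm Ω A) (T : ℕ) : ℝ :=
  ∫ ω, ∑' h, (playLaw σ ρ ω T h).toReal * G.averagePayoff h ∂(G.law : Measure (ℕ → Ω))

/-- The probability that the sender's average payoff over the first `T` periods is at least
`v`. -/
def probPayoffGE (σ : SenderStrategy Ω) (ρ : ReceiverAlgorithm Ω A) (T : ℕ) (v : ℝ) : ENNReal :=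
  ∫⁻ ω, (playLaw σ ρ ω T).toOuterMeasure {h | v ≤ G.averagePayoff h}
    ∂(G.law : Measure (ℕ → Ω))

/-- The sender can guarantee `V` against a mean-based learner: she has forecasting strategies, one
for each horizon `T` and chosen without knowing the learner, such that against every mean-based
learner and for every `ε > 0` her average payoff in the `T`-period game is at least `V - ε`, in
expectation for all large `T`, and with a probability that tends to one. -/
def SenderGuarantees (V : ℝ) : Prop :=
  ∃ σ : ℕ → SenderStrategy Ω, ∀ ρ : ℕ → ReceiverAlgorithm Ω A, IsMeanBased G.uR ρ →
    ∀ ε > 0,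
      (∀ᶠ T in atTop, V - ε ≤ G.expectedPayoff (σ T) (ρ T) T) ∧
      Tendsto (fun T => G.probPayoffGE (σ T) (ρ T) T (V - ε)) atTop (𝓝 1)

/-! ### The distribution of conditionals and the persuasion problem -/

/-- The conditional probability of the states in period `t`, given the states before `t`. -/
def conditional (t : ℕ) (ω : ℕ → Ω) (x : Ω) : ℝ :=
  (ProbabilityTheory.cond (G.law : Measure (ℕ → Ω)) {ω' | ∀ s < t, ω' s = ω s}).real
    {ω' | ω' t = x}

open Classical in
/-- `C` is the distribution of conditionals of the state process: for almost every path, the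
long-run frequency of each conditional `p` is `C {p}`. -/
def IsDistributionOfConditionals (C : ProbabilityMeasure (stdSimplex ℝ Ω)) : Prop :=
  ∀ᵐ ω ∂(G.law : Measure (ℕ → Ω)), ∀ p : stdSimplex ℝ Ω,
    Tendsto
      (fun T : ℕ => (((Finset.range T).filter fun t => G.conditional t ω = ⇑p).card : ℝ) / T)
      atTop (𝓝 ((C : Measure (stdSimplex ℝ Ω)).real {p}))

/-- The receiver's optimal actions when his belief is `q`. -/
def optimalActions (q : stdSimplex ℝ Ω) : Set A :=
  {a | ∀ b, ∑ x, q x * G.uR x b ≤ ∑ x, q x * G.uR x a}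

/-- The sender's indirect utility: her expected payoff when the state is drawn according to `q` and
the receiver takes an optimal action for `q`, ties being broken in favor of the sender. -/
def indirectUtility (q : stdSimplex ℝ Ω) : ℝ :=
  sSup ((fun a => ∑ x, q x * G.uS x a) '' G.optimalActions q)

end Game

/-- `Q` is a simple mean-preserving contraction of `P`: both are finitely supported, and a
row-stochastic matrix `M` merges the fraction `M i j` of the mass `l i` at `p i` into the mass
`m j` at `q j`. -/
def IsSimpleMPC (Q P : ProbabilityMeasure (stdSimplex ℝ Ω)) : Prop :=
  ∃ (n k : ℕ) (l : Fin n → ℝ) (p : Fin n → stdSimplex ℝ Ω)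
    (m : Fin k → ℝ) (q : Fin k → stdSimplex ℝ Ω) (M : Matrix (Fin n) (Fin k) ℝ),
    (∀ i, 0 < l i) ∧ Function.Injective p ∧ Function.Injective q ∧
    (P : Measure (stdSimplex ℝ Ω)) = ∑ i, ENNReal.ofReal (l i) • Measure.dirac (p i) ∧
    (Q : Measure (stdSimplex ℝ Ω)) = ∑ j, ENNReal.ofReal (m j) • Measure.dirac (q j) ∧
    (∀ i j, 0 ≤ M i j) ∧ (∀ i, ∑ j, M i j = 1) ∧
    (∀ j, ∑ i, l i * M i j = m j) ∧
    (∀ j x, ∑ i, l i * p i x * M i j = m j * q j x)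

/-- `Q` is a mean-preserving contraction of `P`: a weak limit of simple ones. -/
def IsMPC (Q P : ProbabilityMeasure (stdSimplex ℝ Ω)) : Prop :=
  ∃ R : ℕ → ProbabilityMeasure (stdSimplex ℝ Ω),
    (∀ n, IsSimpleMPC (R n) P) ∧ Tendsto R atTop (𝓝 Q)

/-- `v` is the value of the persuasion problem with prior `P`: the maximum of the expected indirect
utility of the sender over all mean-preserving contractions of `P`. -/
def Game.IsPersuasionValue (G : Game Ω A) (P : ProbabilityMeasure (stdSimplex ℝ Ω)) (v : ℝ) :
    Prop :=
  IsGreatest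
    {u : ℝ | ∃ Q : ProbabilityMeasure (stdSimplex ℝ Ω), IsMPC Q P ∧
      u = ∫ q, G.indirectUtility q ∂(Q : Measure (stdSimplex ℝ Ω))} v

end Play

/-! ### The example -/

/-- The distribution on two states that gives probability `p` to the second one. -/
def binary (p : ℝ) (h0 : 0 ≤ p) (h1 : p ≤ 1) : stdSimplex ℝ (Fin 2) :=
  ⟨![1 - p, p], by
    constructor
    · intro i
      fin_cases i
      · simpa using h1
      · simpa using h0
    · simp [Fin.sum_univ_two]⟩

/-- The game with two states and four actions. The state process is the stationary Markov chain
that keeps its current state with probability `4/5`. -/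
def exampleGame : Game (Fin 2) (Fin 4) where
  uS := ![![2, 0, 4, 2],
          ![2, 4, 0, 2]]
  uR := ![![8, 7, 3, 0],
          ![0, 3, 7, 8]]
  law := markovLaw (binary (1 / 2) (by norm_num) (by norm_num))
    ![binary (1 / 5) (by norm_num) (by norm_num), binary (4 / 5) (by norm_num) (by norm_num)]

/-- The distribution with equal mass on the conditionals `1/5` and `4/5`. -/
def exampleConditionals : ProbabilityMeasure (stdSimplex ℝ (Fin 2)) :=
  ⟨(1 / 2 : ENNReal) • Measure.dirac (binary (1 / 5) (by norm_num) (by norm_num)) +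
    (1 / 2 : ENNReal) • Measure.dirac (binary (4 / 5) (by norm_num) (by norm_num)), by
    constructor
    simp [ENNReal.inv_two_add_inv_two]⟩

end Forecasting

end

/-! A mean-based learner sees, for each forecast, only the empirical law of the states that followed
it, so he is slow to notice that a forecast has changed its meaning. The sender announces the true
conditional until time T/2 and the opposite one afterwards (`exampleForecast`). Call a forecast's
index its label, number states and actions from 0, and for label `c` let x and y count the past
periods with that label and with state `c`, respectively `1 - c`.

Up to T/2, x ≈ 2t/5 and y ≈ t/10; from then on x ≈ 3T/20 + t/10 and y ≈ 2t/5 - 3T/20. The extreme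
action (0 for label 0, 3 for label 1) leads while x > 3y, which lasts until t = 6T/11. The moderate
action (1 or 2) then leads while x > y, which lasts until T. Extreme actions always pay the sender
2. The moderate action pays 4 exactly when the state differs from the label; after T/2 this means
that the chain stays put, an event of frequency 4/5. The average is thus (6/11)·2 + (5/11)·(16/5) =
28/11.

For the persuasion value, the indirect utility never exceeds 2 (`indirectUtility_le_two`) and equals
2 at both conditionals.

The sender is deterministic and ignores actions, so along a fixed path of states the learner's
cumulative payoffs do not depend on his play. Frequencies come from a strong law for the chain
(`ae_isTypicalPath`), the learner's ranking from `leadingAction_margin`, and the randomness of his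
play is handled by Markov's inequality (`toOuterMeasure_averagePayoff_lt_le`). Dominated convergence
over paths then gives the claim in probability, and payoffs being nonnegative gives it in
expectation. -/

noncomputable section

namespace Forecasting

/-! ### Disintegration and strong law of large numbers for a finite Markov chain. -/

section MarkovChainLaw

variable {Ω : Type*} [Fintype Ω] [MeasurableSpace Ω] [DiscreteMeasurableSpace Ω]

lemma integral_weightMeasure (p : stdSimplex ℝ Ω) (g : Ω → ℝ) :
    ∫ x, g x ∂(weightMeasure p) = ∑ x, p x * g x := by
  have hi : ∀ x ∈ (Finset.univ : Finset Ω),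
      Integrable g (ENNReal.ofReal (p x) • Measure.dirac x) := fun x _ =>
    (integrable_dirac (by finiteness)).smul_measure ENNReal.ofReal_ne_top
  rw [weightMeasure, integral_finsetSum_measure hi]
  refine Finset.sum_congr rfl fun x _ => ?_
  rw [integral_smul_measure, integral_dirac, ENNReal.toReal_ofReal (show 0 ≤ p x from p.2.1 x),
    smul_eq_mul]

/-- One-step disintegration of the Markov chain. -/
lemma integral_markovLaw_succ (p₀ : stdSimplex ℝ Ω) (K : Ω → stdSimplex ℝ Ω) (n : ℕ)
    (F : (∀ _ : Finset.Iic n, Ω) → Ω → ℝ) :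
    ∫ ω, F (Preorder.frestrictLe n ω) (ω (n + 1)) ∂(markovLaw p₀ K : Measure (ℕ → Ω)) =
      ∫ ω, ∑ y, K (ω n) y * F (Preorder.frestrictLe n ω) y
        ∂(markovLaw p₀ K : Measure (ℕ → Ω)) := by
  have hm := Kernel.map_frestrictLe_trajMeasure_compProd_eq_map_trajMeasure
    (X := fun _ => Ω) (μ₀ := weightMeasure p₀) (κ := stepKernel K) (a := n)
  have hF : Measurable (fun z : (∀ _ : Finset.Iic n, Ω) × Ω => F z.1 z.2) :=
    measurable_of_countable _
  have h1 : ∫ ω, F (Preorder.frestrictLe n ω) (ω (n + 1))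
        ∂(markovLaw p₀ K : Measure (ℕ → Ω)) =
      ∫ z, F z.1 z.2 ∂((Kernel.trajMeasure (X := fun _ => Ω) (weightMeasure p₀)
        (stepKernel K)).map (fun x ↦ (Preorder.frestrictLe n x, x (n + 1)))) := by
    rw [integral_map (by fun_prop) hF.aestronglyMeasurable]
    rfl
  have : IsProbabilityMeasure ((Kernel.trajMeasure (X := fun _ => Ω) (weightMeasure p₀)
        (stepKernel K)).map (Preorder.frestrictLe n)) :=
    Measure.isProbabilityMeasure_map (by fun_prop)
  rw [h1, ← hm, Measure.integral_compProd .of_finite, integral_map (by fun_prop)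
    (measurable_of_countable _).aestronglyMeasurable]
  refine integral_congr_ae (ae_of_all _ fun ω => ?_)
  exact integral_weightMeasure _ _

lemma integral_markovLaw_zero (p₀ : stdSimplex ℝ Ω) (K : Ω → stdSimplex ℝ Ω) (g : Ω → ℝ) :
    ∫ ω, g (ω 0) ∂(markovLaw p₀ K : Measure (ℕ → Ω)) = ∑ x, p₀ x * g x := by
  have h : (markovLaw p₀ K : Measure (ℕ → Ω)).map (Preorder.frestrictLe 0) =
      (weightMeasure p₀).map (MeasurableEquiv.piUnique (fun _ : Finset.Iic 0 => Ω)).symm := by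
    change (Kernel.trajMeasure (X := fun _ => Ω) (weightMeasure p₀) (stepKernel K)).map _ = _
    rw [Kernel.trajMeasure, Measure.map_comp _ _ (by fun_prop), Kernel.traj_map_frestrictLe,
      Kernel.partialTraj_self, Measure.id_comp]
  have h1 : ∫ ω, g (ω 0) ∂(markovLaw p₀ K : Measure (ℕ → Ω)) =
      ∫ z, g (z ⟨0, by simp⟩)
        ∂((markovLaw p₀ K : Measure (ℕ → Ω)).map (Preorder.frestrictLe 0)) := by
    rw [integral_map (by fun_prop) (measurable_of_countable _).aestronglyMeasurable]
    rfl
  rw [h1, h, integral_map (by fun_prop) (measurable_of_countable _).aestronglyMeasurable,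
    ← integral_weightMeasure]
  rfl

/-- The increments of the additive functional of a function with conditional mean zero are
orthogonal to all functions of the past. -/
lemma integral_past_mul_centered (p₀ : stdSimplex ℝ Ω) (K : Ω → stdSimplex ℝ Ω)
    (g : Ω → Ω → ℝ) (hg : ∀ x, ∑ y, K x y * g x y = 0) (n : ℕ)
    (F : (∀ _ : Finset.Iic n, Ω) → ℝ) :
    ∫ ω, F (Preorder.frestrictLe n ω) * g (ω n) (ω (n + 1))
      ∂(markovLaw p₀ K : Measure (ℕ → Ω)) = 0 := by
  have h := integral_markovLaw_succ p₀ K n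
    (fun z y => F z * g (z ⟨n, Finset.mem_Iic.2 le_rfl⟩) y)
  refine h.trans ?_
  rw [← integral_zero (ℕ → Ω) ℝ]
  refine integral_congr_ae (ae_of_all _ fun ω => ?_)
  simp only [Preorder.frestrictLe_apply]
  calc _ = F (Preorder.frestrictLe n ω) * ∑ y, K (ω n) y * g (ω n) y := by
        rw [Finset.mul_sum]
        exact Finset.sum_congr rfl fun y _ => by ring
    _ = 0 := by rw [hg, mul_zero]

/-- The additive functional of `g` up to time `n`. -/
def pathSum (g : Ω → Ω → ℝ) (n : ℕ) (ω : ℕ → Ω) : ℝ :=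
  ∑ t ∈ Finset.range n, g (ω t) (ω (t + 1))

lemma measurable_transition (g : Ω → Ω → ℝ) (n : ℕ) :
    Measurable fun ω : ℕ → Ω => g (ω n) (ω (n + 1)) := by
  have h : Measurable fun z : Ω × Ω => g z.1 z.2 := measurable_of_countable _
  have h2 : Measurable fun ω : ℕ → Ω => (ω n, ω (n + 1)) := by fun_prop
  exact h.comp h2

lemma measurable_pathSum (g : Ω → Ω → ℝ) (n : ℕ) : Measurable (pathSum g n) := by
  unfold pathSum
  exact Finset.measurable_sum _ fun t _ => measurable_transition g t

omit [Fintype Ω] [MeasurableSpace Ω] [DiscreteMeasurableSpace Ω] in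
lemma abs_pathSum_le {g : Ω → Ω → ℝ} {C : ℝ} (hC : ∀ x y, |g x y| ≤ C) (n : ℕ) (ω : ℕ → Ω) :
    |pathSum g n ω| ≤ n * C := by
  refine (Finset.abs_sum_le_sum_abs _ _).trans ?_
  refine (Finset.sum_le_sum fun t _ => hC (ω t) (ω (t + 1))).trans ?_
  simp

lemma integrable_of_abs_le {X : Type*} [MeasurableSpace X] {μ : Measure X} [IsFiniteMeasure μ]
    {f : X → ℝ} (hf : Measurable f) (C : ℝ) (hC : ∀ x, |f x| ≤ C) : Integrable f μ :=
  Integrable.of_bound hf.aestronglyMeasurable C (ae_of_all _ hC)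

/-- Each increment is orthogonal to the sum before it, so second moments add up. -/
lemma integral_pathSum_sq_le (p₀ : stdSimplex ℝ Ω) (K : Ω → stdSimplex ℝ Ω)
    (g : Ω → Ω → ℝ) (hg : ∀ x, ∑ y, K x y * g x y = 0) {C : ℝ} (hC : ∀ x y, |g x y| ≤ C)
    (n : ℕ) :
    ∫ ω, pathSum g n ω ^ 2 ∂(markovLaw p₀ K : Measure (ℕ → Ω)) ≤ n * C ^ 2 := by
  induction n with
  | zero => simp [pathSum]
  | succ n ih =>
    set μ := (markovLaw p₀ K : Measure (ℕ → Ω))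
    have hmS := measurable_pathSum (Ω := Ω) g n
    have hmg : Measurable fun ω : ℕ → Ω => g (ω n) (ω (n + 1)) := measurable_transition g n
    have hS := abs_pathSum_le hC n
    have hsq (ω : ℕ → Ω) : g (ω n) (ω (n + 1)) ^ 2 ≤ C ^ 2 :=
      sq_le_sq' (abs_le.1 (hC _ _)).1 (abs_le.1 (hC _ _)).2
    have hi1 : Integrable (fun ω => pathSum g n ω ^ 2) μ := by
      refine integrable_of_abs_le (hmS.pow_const 2) ((n * C) ^ 2) fun ω => ?_
      rw [abs_pow]
      exact pow_le_pow_left₀ (abs_nonneg _) (hS ω) 2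
    have hi2 : Integrable (fun ω => pathSum g n ω * g (ω n) (ω (n + 1))) μ := by
      refine integrable_of_abs_le (hmS.mul hmg) (n * C * C) fun ω => ?_
      rw [abs_mul]
      exact mul_le_mul (hS ω) (hC _ _) (abs_nonneg _) ((abs_nonneg _).trans (hS ω))
    have hi3 : Integrable (fun ω : ℕ → Ω => g (ω n) (ω (n + 1)) ^ 2) μ := by
      refine integrable_of_abs_le (hmg.pow_const 2) (C ^ 2) fun ω => ?_
      rw [abs_of_nonneg (sq_nonneg _)]
      exact hsq ω
    -- The sum up to `n` reads only the coordinates `0, …, n`, so it is a function of the past.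
    have horth : ∫ ω, pathSum g n ω * g (ω n) (ω (n + 1)) ∂μ = 0 := by
      have := integral_past_mul_centered p₀ K g hg n (fun z =>
        ∑ t : Fin n, g (z ⟨t, Finset.mem_Iic.2 t.2.le⟩) (z ⟨t + 1, Finset.mem_Iic.2 t.2⟩))
      simp only [Preorder.frestrictLe_apply] at this
      simp only [pathSum, Finset.sum_range]
      exact this
    have hexp : ∀ ω : ℕ → Ω, pathSum g (n + 1) ω ^ 2 = pathSum g n ω ^ 2 +
        2 * (pathSum g n ω * g (ω n) (ω (n + 1))) + g (ω n) (ω (n + 1)) ^ 2 := fun ω => by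
      rw [pathSum, Finset.sum_range_succ, ← pathSum]; ring
    have h3 : ∫ ω, g (ω n) (ω (n + 1)) ^ 2 ∂μ ≤ C ^ 2 := by
      refine (integral_mono hi3 (integrable_const (C ^ 2)) hsq).trans ?_
      simp [μ]
    have hi12 : Integrable (fun ω => pathSum g n ω ^ 2 +
        2 * (pathSum g n ω * g (ω n) (ω (n + 1)))) μ := hi1.add (hi2.const_mul 2)
    simp only [hexp]
    rw [integral_add hi12 hi3, integral_add hi1 (hi2.const_mul 2),
      integral_const_mul, horth]
    push_cast
    linarith

/-- Along squares the averages have second moment O(1/n²), which is summable; hence the series of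
their squares is almost surely finite and its terms tend to zero. -/
lemma ae_tendsto_pathSum_sq_div (p₀ : stdSimplex ℝ Ω) (K : Ω → stdSimplex ℝ Ω)
    (g : Ω → Ω → ℝ) (hg : ∀ x, ∑ y, K x y * g x y = 0) :
    ∀ᵐ ω ∂(markovLaw p₀ K : Measure (ℕ → Ω)),
      Tendsto (fun n : ℕ => pathSum g (n ^ 2) ω / ((n ^ 2 : ℕ) : ℝ)) atTop (𝓝 0) := by
  obtain ⟨C, hC⟩ : ∃ C, ∀ x y, |g x y| ≤ C :=
    ⟨∑ x, ∑ y, |g x y|, fun x y =>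
      (Finset.single_le_sum (f := fun y => |g x y|) (fun _ _ => abs_nonneg _)
        (Finset.mem_univ y)).trans
      (Finset.single_le_sum (f := fun x => ∑ y, |g x y|)
        (fun _ _ => Finset.sum_nonneg fun _ _ => abs_nonneg _) (Finset.mem_univ x))⟩
  set μ := (markovLaw p₀ K : Measure (ℕ → Ω))
  let f : ℕ → (ℕ → Ω) → ℝ := fun n ω => (pathSum g (n ^ 2) ω / ((n ^ 2 : ℕ) : ℝ)) ^ 2
  have hfm n : Measurable (f n) := ((measurable_pathSum g _).div_const _).pow_const 2
  have hf0 n ω : 0 ≤ f n ω := sq_nonneg _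
  have hbound n : ∫⁻ ω, ENNReal.ofReal (f n ω) ∂μ ≤ ENNReal.ofReal (C ^ 2 * (1 / (n : ℝ) ^ 2)) := by
    have hi : Integrable (f n) μ := by
      refine integrable_of_abs_le (hfm n) (C ^ 2) fun ω => ?_
      rw [abs_of_nonneg (hf0 n ω)]
      rcases Nat.eq_zero_or_pos n with rfl | hn
      · simpa [f] using sq_nonneg C
      refine sq_le_sq.2 ?_
      rw [abs_div, Nat.abs_cast, div_le_iff₀ (by positivity), mul_comm]
      exact (abs_pathSum_le hC _ ω).trans (by gcongr; exact le_abs_self C)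
    rw [← ofReal_integral_eq_lintegral_ofReal hi (ae_of_all _ (hf0 n))]
    refine ENNReal.ofReal_le_ofReal ?_
    simp only [f, div_pow]
    rw [integral_div]
    rcases Nat.eq_zero_or_pos n with rfl | hn
    · simp
    rw [div_le_iff₀ (by positivity)]
    refine (integral_pathSum_sq_le p₀ K g hg hC (n ^ 2)).trans (le_of_eq ?_)
    push_cast
    field_simp
  have hsum : ∑' n, ∫⁻ ω, ENNReal.ofReal (f n ω) ∂μ ≠ ⊤ := by
    have hs : Summable fun n : ℕ => C ^ 2 * (1 / (n : ℝ) ^ 2) :=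
      (Real.summable_one_div_nat_pow.2 one_lt_two).mul_left _
    refine ne_top_of_le_ne_top ?_ (ENNReal.tsum_le_tsum hbound)
    rw [← ENNReal.ofReal_tsum_of_nonneg (fun n => by positivity) hs]
    exact ENNReal.ofReal_ne_top
  rw [← lintegral_tsum fun n => (hfm n).ennreal_ofReal.aemeasurable] at hsum
  have hae := ae_lt_top' (AEMeasurable.tsum fun n => (hfm n).ennreal_ofReal.aemeasurable) hsum
  filter_upwards [hae] with ω hω
  have h0 : Tendsto (fun n => f n ω) atTop (𝓝 0) := by
    have := ENNReal.tendsto_atTop_zero_of_tsum_ne_top hω.ne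
    have h2 := (ENNReal.tendsto_toReal ENNReal.zero_ne_top).comp this
    simpa [Function.comp_def, ENNReal.toReal_ofReal (hf0 _ _)] using h2
  have h1 := h0.sqrt
  simp only [f, Real.sqrt_sq_eq_abs, Real.sqrt_zero] at h1
  exact (tendsto_zero_iff_abs_tendsto_zero _).2 h1

/-- Strong law of large numbers for functions of consecutive states with conditional mean zero. -/
lemma ae_tendsto_pathSum_div (p₀ : stdSimplex ℝ Ω) (K : Ω → stdSimplex ℝ Ω)
    (g : Ω → Ω → ℝ) (hg : ∀ x, ∑ y, K x y * g x y = 0) :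
    ∀ᵐ ω ∂(markovLaw p₀ K : Measure (ℕ → Ω)),
      Tendsto (fun n : ℕ => pathSum g n ω / n) atTop (𝓝 0) := by
  obtain ⟨C, hC⟩ : ∃ C, ∀ x y, |g x y| ≤ C :=
    ⟨∑ x, ∑ y, |g x y|, fun x y =>
      (Finset.single_le_sum (f := fun y => |g x y|) (fun _ _ => abs_nonneg _)
        (Finset.mem_univ y)).trans
      (Finset.single_le_sum (f := fun x => ∑ y, |g x y|)
        (fun _ _ => Finset.sum_nonneg fun _ _ => abs_nonneg _) (Finset.mem_univ x))⟩
  filter_upwards [ae_tendsto_pathSum_sq_div p₀ K g hg] with ω hω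
  -- Adding `n * C` makes the sums monotone, so the limit along squares extends to all `n`, as
  -- consecutive squares have ratio tending to 1.
  have key : Tendsto (fun n : ℕ => (pathSum g n ω + n * C) / n) atTop (𝓝 C) := by
    refine tendsto_div_of_monotone_of_exists_subseq_tendsto_div
      (fun n => pathSum g n ω + n * C) C ?_ ?_
    · refine monotone_nat_of_le_succ fun n => ?_
      have := (abs_le.1 (hC (ω n) (ω (n + 1)))).1
      simp only [pathSum, Finset.sum_range_succ]
      push_cast
      linarith
    · intro a ha
      refine ⟨fun n => n ^ 2, ?_, tendsto_pow_atTop two_ne_zero, ?_⟩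
      · have : Tendsto (fun n : ℕ => (1 + 1 / (n : ℝ)) ^ 2) atTop (𝓝 ((1 + 0) ^ 2)) :=
          (tendsto_const_nhds.add tendsto_one_div_atTop_nhds_zero_nat).pow 2
        have hlt : ((1 : ℝ) + 0) ^ 2 < a := by simpa using ha
        filter_upwards [this.eventually_lt_const hlt, eventually_gt_atTop 0] with n hn hpos
        have hpos' : (0 : ℝ) < n := by exact_mod_cast hpos
        have : (((n + 1) ^ 2 : ℕ) : ℝ) = (1 + 1 / (n : ℝ)) ^ 2 * ((n ^ 2 : ℕ) : ℝ) := by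
          push_cast; field_simp
        rw [this]
        gcongr
      · have h1 := hω.add_const C
        rw [zero_add] at h1
        refine h1.congr' ?_
        filter_upwards [eventually_gt_atTop 0] with n hn
        have : (0 : ℝ) < ((n ^ 2 : ℕ) : ℝ) := by positivity
        field_simp
  have h2 := key.sub_const C
  rw [sub_self] at h2
  refine h2.congr' ?_
  filter_upwards [eventually_gt_atTop 0] with n hn
  have : (0 : ℝ) < (n : ℝ) := by positivity
  field_simp
  ring

end MarkovChainLaw

/-! ### Conditional laws given the past. -/

section Cylinders

variable {Ω : Type*} [Fintype Ω] [MeasurableSpace Ω] [DiscreteMeasurableSpace Ω]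

omit [Fintype Ω] in
lemma measurableSet_agree [Countable Ω] (t : ℕ) (ω : ℕ → Ω) :
    MeasurableSet {ω' : ℕ → Ω | ∀ s < t, ω' s = ω s} := by
  have : {ω' : ℕ → Ω | ∀ s < t, ω' s = ω s} = ⋂ s, ⋂ (_ : s < t), {ω' | ω' s = ω s} := by
    ext; simp
  rw [this]
  exact MeasurableSet.iInter fun s => MeasurableSet.iInter fun _ =>
    measurableSet_eq_fun (measurable_pi_apply s) measurable_const

lemma measurableSet_coord (t : ℕ) (x : Ω) : MeasurableSet {ω' : ℕ → Ω | ω' t = x} :=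
  measurableSet_eq_fun (measurable_pi_apply t) measurable_const

open Classical in
lemma markovLaw_real_agree_inter (p₀ : stdSimplex ℝ Ω) (K : Ω → stdSimplex ℝ Ω) (t : ℕ)
    (ω : ℕ → Ω) (x : Ω) :
    (markovLaw p₀ K : Measure (ℕ → Ω)).real
        ({ω' | ∀ s < t + 1, ω' s = ω s} ∩ {ω' | ω' (t + 1) = x}) =
      K (ω t) x * (markovLaw p₀ K : Measure (ℕ → Ω)).real {ω' | ∀ s < t + 1, ω' s = ω s} := by
  have hA := measurableSet_agree (t + 1) ω
  have h := integral_markovLaw_succ p₀ K t (fun z y =>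
    if (∀ s : Finset.Iic t, z s = ω s) ∧ y = x then 1 else 0)
  have hiff (ω' : ℕ → Ω) : (∀ s : Finset.Iic t, Preorder.frestrictLe t ω' s = ω s) ↔
      ω' ∈ {ω' | ∀ s < t + 1, ω' s = ω s} := by
    simp [Preorder.frestrictLe_apply]
  simp only [hiff] at h
  rw [← integral_indicator_one (hA.inter (measurableSet_coord _ _)),
    ← integral_indicator_one hA, ← integral_const_mul]
  refine Eq.trans (integral_congr_ae (ae_of_all _ fun ω' => ?_))
    (h.trans (integral_congr_ae (ae_of_all _ fun ω' => ?_)))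
  · simp [Set.indicator_apply]
  · by_cases hω : ω' ∈ {ω' | ∀ s < t + 1, ω' s = ω s}
    · have := hω t (Nat.lt_succ_self t)
      simp only [hω, this, true_and, Set.indicator_of_mem, Pi.one_apply, mul_one]
      simp
    · simp only [hω, false_and, if_false, mul_zero, Finset.sum_const_zero, not_false_eq_true,
        Set.indicator_of_notMem]

/-- Ensures that `Game.conditional` never conditions on a null event. -/
lemma markovLaw_real_agree_pos (p₀ : stdSimplex ℝ Ω) (K : Ω → stdSimplex ℝ Ω)
    (h0 : ∀ x, 0 < p₀ x) (hK : ∀ x y, 0 < K x y) (t : ℕ) (ω : ℕ → Ω) :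
    0 < (markovLaw p₀ K : Measure (ℕ → Ω)).real {ω' | ∀ s < t, ω' s = ω s} := by
  classical
  have hsucc (t : ℕ) : {ω' : ℕ → Ω | ∀ s < t + 1, ω' s = ω s} =
      {ω' | ∀ s < t, ω' s = ω s} ∩ {ω' | ω' t = ω t} := by
    ext ω'
    simp only [Set.mem_ofPred_eq, Set.mem_inter_iff, Nat.lt_succ_iff_lt_or_eq]
    constructor
    · exact fun h => ⟨fun s hs => h s (.inl hs), h t (.inr rfl)⟩
    · rintro ⟨h1, h2⟩ s (hs | rfl)
      exacts [h1 s hs, h2]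
  induction t with
  | zero => simp
  | succ t ih =>
    rw [hsucc]
    cases t with
    | zero =>
      have h := integral_markovLaw_zero p₀ K (fun x => if x = ω 0 then 1 else 0)
      have : {ω' : ℕ → Ω | ∀ s < 0, ω' s = ω s} ∩ {ω' | ω' 0 = ω 0} = {ω' | ω' 0 = ω 0} := by
        simp
      rw [this, ← integral_indicator_one (measurableSet_coord _ _)]
      refine lt_of_lt_of_eq (h0 (ω 0)) ?_
      simp only [mul_ite, mul_one, mul_zero, Finset.sum_ite_eq', Finset.mem_univ, if_true] at h
      rw [← h]
      exact integral_congr_ae (ae_of_all _ fun ω' => by simp [Set.indicator_apply])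
    | succ t =>
      rw [markovLaw_real_agree_inter]
      exact mul_pos (hK _ _) ih

/-- For a chain with positive transition probabilities, the conditional law of the next state
given the past is the transition law from the current state, along every path. -/
lemma conditional_succ_eq {A : Type*} (G : Game Ω A) (p₀ : stdSimplex ℝ Ω)
    (K : Ω → stdSimplex ℝ Ω) (hG : G.law = markovLaw p₀ K)
    (h0 : ∀ x, 0 < p₀ x) (hK : ∀ x y, 0 < K x y) (t : ℕ) (ω : ℕ → Ω) :
    G.conditional (t + 1) ω = K (ω t) := by
  funext x
  rw [Game.conditional, hG, Measure.real, cond_apply (measurableSet_agree _ _),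
    ENNReal.toReal_mul, ENNReal.toReal_inv, ← Measure.real, ← Measure.real,
    markovLaw_real_agree_inter]
  have := markovLaw_real_agree_pos p₀ K h0 hK (t + 1) ω
  field_simp

end Cylinders

/-! ### Averages under a time shift. -/

section Averages

/-- Passes from functions of the state at `t` to functions of the state before `t + 1`; the
arbitrary initial value `b 0` is negligible. -/
lemma tendsto_average_of_shift {a b : ℕ → ℝ} {l : ℝ} (hab : ∀ t, b (t + 1) = a t)
    (ha : Tendsto (fun n : ℕ => (∑ t ∈ Finset.range n, a t) / n) atTop (𝓝 l)) :
    Tendsto (fun n : ℕ => (∑ t ∈ Finset.range n, b t) / n) atTop (𝓝 l) := by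
  rw [← tendsto_add_atTop_iff_nat 1]
  have h1 : Tendsto (fun n : ℕ => 1 / ((n : ℝ) + 1)) atTop (𝓝 0) :=
    tendsto_one_div_add_atTop_nhds_zero_nat
  have h2 : Tendsto (fun n : ℕ => (∑ t ∈ Finset.range n, a t) / n * (1 - 1 / ((n : ℝ) + 1)) +
      b 0 * (1 / ((n : ℝ) + 1))) atTop (𝓝 (l * (1 - 0) + b 0 * 0)) :=
    (ha.mul (tendsto_const_nhds.sub h1)).add (h1.const_mul _)
  simp only [sub_zero, mul_one, mul_zero, add_zero] at h2
  refine h2.congr' ?_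
  filter_upwards [eventually_gt_atTop 0] with n hn
  have : (0 : ℝ) < n := by exact_mod_cast hn
  rw [Finset.sum_range_succ']
  simp only [hab]
  push_cast
  field_simp
  ring

end Averages

/-! ### Transition frequencies and the distribution of conditionals. -/

section TwoStates

/-- The number of `t < n` at which the path jumps from `i` to `j`. -/
def pairCount (i j : Fin 2) (n : ℕ) (ω : ℕ → Fin 2) : ℝ :=
  ∑ t ∈ Finset.range n, if ω t = i ∧ ω (t + 1) = j then 1 else 0

/-- Every transition occurs with its stationary frequency. -/
def IsTypicalPath (ω : ℕ → Fin 2) : Prop :=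
  ∀ i j, Tendsto (fun n : ℕ => pairCount i j n ω / n) atTop
    (𝓝 (if i = j then 2 / 5 else 1 / 10))

/-- The transition law of the example. -/
def exampleKernel : Fin 2 → stdSimplex ℝ (Fin 2) :=
  ![binary (1 / 5) (by norm_num) (by norm_num), binary (4 / 5) (by norm_num) (by norm_num)]

lemma binary_zero (p : ℝ) (h0 : 0 ≤ p) (h1 : p ≤ 1) : binary p h0 h1 0 = 1 - p := rfl

lemma binary_one (p : ℝ) (h0 : 0 ≤ p) (h1 : p ≤ 1) : binary p h0 h1 1 = p := rfl

lemma exampleGame_law : exampleGame.law =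
    markovLaw (binary (1 / 2) (by norm_num) (by norm_num)) exampleKernel := rfl

/-- The two states as signs. -/
def stateSign : Fin 2 → ℝ := ![1, -1]

/-- Reduces pair frequencies to averages of the signs and of the products of consecutive signs. -/
lemma indicator_pair_eq (i j x y : Fin 2) : (if x = i ∧ y = j then (1 : ℝ) else 0) =
    (1 + stateSign i * stateSign x + stateSign j * stateSign y +
      stateSign i * stateSign j * (stateSign x * stateSign y)) / 4 := by
  fin_cases i <;> fin_cases j <;> fin_cases x <;> fin_cases y <;> norm_num [stateSign]

lemma tendsto_sign_div (ω : ℕ → Fin 2) :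
    Tendsto (fun n : ℕ => (stateSign (ω n) - stateSign (ω 0)) / (n : ℝ)) atTop (𝓝 0) := by
  have hb (x : Fin 2) : |stateSign x| ≤ 1 := by fin_cases x <;> simp [stateSign]
  refine squeeze_zero_norm (a := fun n : ℕ => 2 * (1 / (n : ℝ))) (fun n => ?_) ?_
  · rw [Real.norm_eq_abs, abs_div, Nat.abs_cast, mul_one_div]
    gcongr
    exact (abs_sub _ _).trans (by linarith [hb (ω n), hb (ω 0)])
  · simpa using tendsto_one_div_atTop_nhds_zero_nat.const_mul (2 : ℝ)

lemma ae_isTypicalPath :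
    ∀ᵐ ω ∂(exampleGame.law : Measure (ℕ → Fin 2)), IsTypicalPath ω := by
  rw [exampleGame_law]
  -- The next sign has conditional mean 4/5 - 1/5 = 3/5 times the current one, which centers both
  -- functions.
  have h1 := ae_tendsto_pathSum_div (binary (1 / 2) (by norm_num) (by norm_num)) exampleKernel
    (fun x y => stateSign x * stateSign y - 3 / 5) (fun x => by
      fin_cases x <;>
        norm_num [exampleKernel, stateSign, Fin.sum_univ_two, binary_zero, binary_one])
  have h2 := ae_tendsto_pathSum_div (binary (1 / 2) (by norm_num) (by norm_num)) exampleKernel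
    (fun x y => stateSign y - 3 / 5 * stateSign x) (fun x => by
      fin_cases x <;>
        norm_num [exampleKernel, stateSign, Fin.sum_univ_two, binary_zero, binary_one])
  filter_upwards [h1, h2] with ω h1 h2 i j
  have h3 := tendsto_sign_div ω
  set g1 : Fin 2 → Fin 2 → ℝ := fun x y => stateSign x * stateSign y - 3 / 5
  set g2 : Fin 2 → Fin 2 → ℝ := fun x y => stateSign y - 3 / 5 * stateSign x
  -- Let A and B sum the signs of `ω t` and `ω (t + 1)`, and D = B - A, which telescopes. The sum of
  -- `g2` is B - 3A/5, and solving gives A = 5/2 (sum - D), B = 5/2 sum - 3/2 D.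
  have key (n : ℕ) : pairCount i j n ω =
      (n + stateSign i * (5 / 2 * (pathSum g2 n ω - (stateSign (ω n) - stateSign (ω 0)))) +
        stateSign j * (5 / 2 * pathSum g2 n ω - 3 / 2 * (stateSign (ω n) - stateSign (ω 0))) +
        stateSign i * stateSign j * (pathSum g1 n ω + 3 / 5 * n)) / 4 := by
    induction n with
    | zero => simp [pairCount, pathSum]
    | succ n ih =>
      simp only [pairCount, pathSum, Finset.sum_range_succ] at ih ⊢
      rw [ih, indicator_pair_eq]
      simp only [g1, g2]
      push_cast
      ring
  have hlim : Tendsto (fun n : ℕ =>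
      (1 + stateSign i * (5 / 2 * (pathSum g2 n ω / n -
          (stateSign (ω n) - stateSign (ω 0)) / n)) +
        stateSign j * (5 / 2 * (pathSum g2 n ω / n) -
          3 / 2 * ((stateSign (ω n) - stateSign (ω 0)) / n)) +
        stateSign i * stateSign j * (pathSum g1 n ω / n + 3 / 5)) / 4) atTop
      (𝓝 ((1 + stateSign i * (5 / 2 * (0 - 0)) + stateSign j * (5 / 2 * 0 - 3 / 2 * 0) +
        stateSign i * stateSign j * (0 + 3 / 5)) / 4)) :=
    (((tendsto_const_nhds.add (((h2.sub h3).const_mul _).const_mul _)).add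
      (((h2.const_mul _).sub (h3.const_mul _)).const_mul _)).add
      ((h1.add_const _).const_mul _)).div_const _
  have hval : (1 + stateSign i * (5 / 2 * (0 - 0)) + stateSign j * (5 / 2 * 0 - 3 / 2 * 0) +
        stateSign i * stateSign j * (0 + 3 / 5)) / 4 = if i = j then (2 / 5 : ℝ) else 1 / 10 := by
    fin_cases i <;> fin_cases j <;> norm_num [stateSign]
  rw [hval] at hlim
  refine hlim.congr' ?_
  filter_upwards [eventually_gt_atTop 0] with n hn
  have : (0 : ℝ) < n := by exact_mod_cast hn
  rw [key]
  field_simp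

lemma IsTypicalPath.tendsto_average {ω : ℕ → Fin 2} (hω : IsTypicalPath ω) (φ : Fin 2 → ℝ) :
    Tendsto (fun n : ℕ => (∑ t ∈ Finset.range n, φ (ω t)) / n) atTop (𝓝 ((φ 0 + φ 1) / 2)) := by
  have h : Tendsto (fun n : ℕ => ∑ i, ∑ j, φ i * (pairCount i j n ω / n)) atTop
      (𝓝 (∑ i : Fin 2, ∑ j : Fin 2, φ i * (if i = j then 2 / 5 else 1 / 10))) :=
    tendsto_finsetSum _ fun i _ => tendsto_finsetSum _ fun j _ => (hω i j).const_mul _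
  have hval : (∑ i : Fin 2, ∑ j : Fin 2, φ i * (if i = j then 2 / 5 else 1 / 10)) =
      (φ 0 + φ 1) / 2 := by
    norm_num [Fin.sum_univ_two]; ring
  rw [hval] at h
  refine h.congr fun n => ?_
  simp only [pairCount, Finset.sum_div, Finset.mul_sum, Fin.sum_univ_two,
    ← Finset.sum_add_distrib]
  refine Finset.sum_congr rfl fun t _ => ?_
  generalize ω t = x
  generalize ω (t + 1) = y
  fin_cases x <;> fin_cases y <;> simp <;> ring

lemma exampleKernel_injective : Function.Injective exampleKernel := by
  intro i j h
  have h1 : exampleKernel i 1 = exampleKernel j 1 := by rw [h]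
  fin_cases i <;> fin_cases j <;>
    first
      | rfl
      | (exfalso; norm_num [exampleKernel, binary_one] at h1)

lemma exampleConditionals_eq : (exampleConditionals : Measure (stdSimplex ℝ (Fin 2))) =
    (1 / 2 : ENNReal) • Measure.dirac (exampleKernel 0) +
    (1 / 2 : ENNReal) • Measure.dirac (exampleKernel 1) := rfl

open Classical in
lemma exampleConditionals_real_singleton (p : stdSimplex ℝ (Fin 2)) :
    (exampleConditionals : Measure (stdSimplex ℝ (Fin 2))).real {p} =
      ((if exampleKernel 0 = p then 1 else 0) + (if exampleKernel 1 = p then 1 else 0)) / 2 := by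
  rw [exampleConditionals_eq, Measure.real, Measure.add_apply, Measure.smul_apply,
    Measure.smul_apply, Measure.dirac_apply, Measure.dirac_apply]
  simp only [Set.indicator_apply, Set.mem_singleton_iff]
  have h01 : exampleKernel 0 ≠ exampleKernel 1 := exampleKernel_injective.ne (by decide)
  by_cases h0 : exampleKernel 0 = p
  · have h1 : exampleKernel 1 ≠ p := fun h => h01 (h0.trans h.symm)
    simp [h0, h1]
  · by_cases h1 : exampleKernel 1 = p <;> simp [h0, h1]

lemma exampleKernel_pos (x y : Fin 2) : 0 < exampleKernel x y := by
  fin_cases x <;> fin_cases y <;> norm_num [exampleKernel, binary_zero, binary_one]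

lemma example_isDistributionOfConditionals :
    exampleGame.IsDistributionOfConditionals exampleConditionals := by
  classical
  filter_upwards [ae_isTypicalPath] with ω hω p
  rw [exampleConditionals_real_singleton]
  have h := tendsto_average_of_shift
    (b := fun t => if exampleGame.conditional t ω = ⇑p then 1 else 0) (fun t => ?_)
    (hω.tendsto_average fun x => if exampleKernel x = p then 1 else 0)
  · refine h.congr fun n => ?_
    congr 1
    rw [Finset.card_filter]
    push_cast
    exact Finset.sum_congr rfl fun t _ => by congr
  · rw [conditional_succ_eq exampleGame _ _ exampleGame_law (fun x => ?_) exampleKernel_pos]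
    · simp only [DFunLike.coe_injective.eq_iff]
    · fin_cases x <;> norm_num [binary_zero, binary_one]

end TwoStates

/-! ### The persuasion value. -/

section Persuasion

/-- Actions 0 and 3 pay exactly 2. Action 1 pays 4 `q 1`, but being at least as good as action 2 for
the receiver forces `q 1 ≤ q 0`; action 2 is symmetric. -/
lemma indirectUtility_le_two (q : stdSimplex ℝ (Fin 2)) : exampleGame.indirectUtility q ≤ 2 := by
  have h0 : 0 ≤ q 0 := q.2.1 0
  have h1 : 0 ≤ q 1 := q.2.1 1
  have hs : q 0 + q 1 = 1 := by
    have := q.2.2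
    rwa [Fin.sum_univ_two] at this
  refine Real.sSup_le ?_ (by norm_num)
  rintro _ ⟨a, ha, rfl⟩
  have hb (b : Fin 4) := ha b
  simp only [exampleGame, Fin.sum_univ_two] at hb ⊢
  have e1 := hb 1
  have e2 := hb 2
  clear hb ha
  fin_cases a <;> simp at e1 e2 ⊢ <;> linarith

lemma indirectUtility_exampleKernel (i : Fin 2) :
    exampleGame.indirectUtility (exampleKernel i) = 2 := by
  have hK : ∀ i, exampleKernel i 0 = ![4 / 5, 1 / 5] i ∧ exampleKernel i 1 = ![1 / 5, 4 / 5] i := by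
    intro i
    fin_cases i <;> norm_num [exampleKernel, binary_zero, binary_one]
  refine le_antisymm (indirectUtility_le_two _) ?_
  have hbdd : BddAbove ((fun a => ∑ x, exampleKernel i x * exampleGame.uS x a) ''
      exampleGame.optimalActions (exampleKernel i)) := (Set.toFinite _).bddAbove
  refine le_csSup hbdd ⟨![0, 3] i, fun b => ?_, ?_⟩
  · rw [Fin.sum_univ_two, Fin.sum_univ_two, (hK i).1, (hK i).2]
    fin_cases i <;> fin_cases b <;> simp [exampleGame] <;> norm_num
  · dsimp only
    rw [Fin.sum_univ_two, (hK i).1, (hK i).2]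
    fin_cases i <;> simp [exampleGame] <;> norm_num

lemma IsMPC.refl_of_isSimpleMPC {Ω : Type*} [Fintype Ω] [MeasurableSpace Ω]
    {P : ProbabilityMeasure (stdSimplex ℝ Ω)} (h : IsSimpleMPC P P) : IsMPC P P :=
  ⟨fun _ => P, fun _ => h, tendsto_const_nhds⟩

lemma isSimpleMPC_exampleConditionals : IsSimpleMPC exampleConditionals exampleConditionals := by
  have hm : (exampleConditionals : Measure (stdSimplex ℝ (Fin 2))) =
      ∑ i : Fin 2, ENNReal.ofReal (1 / 2) • Measure.dirac (exampleKernel i) := by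
    have h2 : ENNReal.ofReal (1 / 2) = 1 / 2 := by
      rw [ENNReal.ofReal_div_of_pos two_pos, ENNReal.ofReal_one, ENNReal.ofReal_ofNat]
    rw [exampleConditionals_eq, Fin.sum_univ_two, h2]
  -- The identity matrix: nothing is merged.
  refine ⟨2, 2, fun _ => 1 / 2, exampleKernel, fun _ => 1 / 2, exampleKernel, 1,
    fun _ => by norm_num, exampleKernel_injective, exampleKernel_injective, hm, hm,
    fun i j => ?_, fun i => ?_, fun j => ?_, fun j x => ?_⟩
  · rw [Matrix.one_apply]; split_ifs <;> norm_num
  · simp [Matrix.one_apply]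
  · simp [Matrix.one_apply]
  · simp [Matrix.one_apply]

lemma example_isPersuasionValue : exampleGame.IsPersuasionValue exampleConditionals 2 := by
  constructor
  · refine ⟨exampleConditionals, .refl_of_isSimpleMPC isSimpleMPC_exampleConditionals, ?_⟩
    have hi (i : Fin 2) : Integrable exampleGame.indirectUtility
        ((1 / 2 : ENNReal) • Measure.dirac (exampleKernel i)) :=
      (integrable_dirac (by finiteness)).smul_measure (by finiteness)
    rw [exampleConditionals_eq, integral_add_measure (hi 0) (hi 1), integral_smul_measure,
      integral_smul_measure, integral_dirac, integral_dirac, indirectUtility_exampleKernel,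
      indirectUtility_exampleKernel]
    norm_num
  · rintro _ ⟨Q, -, rfl⟩
    -- Without integrability the integral is 0 by convention, so measurability of the indirect
    -- utility need not be proved.
    by_cases hi : Integrable exampleGame.indirectUtility (Q : Measure (stdSimplex ℝ (Fin 2)))
    · refine (integral_mono hi (integrable_const 2) indirectUtility_le_two).trans ?_
      simp
    · rw [integral_undef hi]
      norm_num

end Persuasion

/-! ### Sums against discrete distributions. -/

section PMFSums

lemma tsum_bind_mul {α β : Type*} (p : PMF α) (f : α → PMF β) (g : β → ENNReal) :
    ∑' b, (p.bind f) b * g b = ∑' a, p a * ∑' b, f a b * g b := by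
  simp only [PMF.bind_apply, ← ENNReal.tsum_mul_right, ← ENNReal.tsum_mul_left]
  rw [ENNReal.tsum_comm]
  simp only [mul_assoc]

lemma tsum_pure_mul {α : Type*} (a : α) (g : α → ENNReal) :
    ∑' b, (PMF.pure a) b * g b = g a := by
  rw [tsum_eq_single a fun b hb => by simp [PMF.pure_apply, hb]]
  simp

lemma tsum_map_mul {α β : Type*} (p : PMF α) (f : α → β) (g : β → ENNReal) :
    ∑' b, (p.map f) b * g b = ∑' a, p a * g (f a) := by
  rw [PMF.map, tsum_bind_mul]
  simp only [Function.comp_apply, tsum_pure_mul]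

lemma toOuterMeasure_add_compl {α : Type*} (p : PMF α) (s : Set α) :
    p.toOuterMeasure s + p.toOuterMeasure sᶜ = 1 := by
  rw [PMF.toOuterMeasure_apply, PMF.toOuterMeasure_apply, ← ENNReal.tsum_add, ← p.tsum_coe]
  exact tsum_congr fun a => congrFun (Set.indicator_self_add_compl s p) a

lemma toOuterMeasure_mul_le_tsum {α : Type*} (p : PMF α) (s : Set α) (g : α → ENNReal)
    (c : ENNReal) (h : ∀ a ∈ p.support, a ∈ s → c ≤ g a) :
    p.toOuterMeasure s * c ≤ ∑' a, p a * g a := by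
  rw [PMF.toOuterMeasure_apply, ← ENNReal.tsum_mul_right]
  refine ENNReal.tsum_le_tsum fun a => ?_
  by_cases hs : a ∈ s
  · rw [Set.indicator_of_mem hs]
    by_cases hp : a ∈ p.support
    · gcongr
      exact h a hp hs
    · simp [(PMF.apply_eq_zero_iff p a).2 hp]
  · simp [hs]

lemma summable_toReal_mul {α : Type*} (p : PMF α) (g : α → ℝ) {C : ℝ}
    (h0 : ∀ a, 0 ≤ g a) (hC : ∀ a, g a ≤ C) : Summable fun a => (p a).toReal * g a := by
  have hp : Summable fun a => (p a).toReal := ENNReal.summable_toReal p.tsum_coe_ne_top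
  exact Summable.of_nonneg_of_le (fun a => mul_nonneg ENNReal.toReal_nonneg (h0 a))
    (fun a => mul_le_mul_of_nonneg_left (hC a) ENNReal.toReal_nonneg) (hp.mul_right C)

lemma tsum_toReal_eq_one {α : Type*} (p : PMF α) : ∑' a, (p a).toReal = 1 := by
  rw [← ENNReal.tsum_toReal_eq p.apply_ne_top, p.tsum_coe, ENNReal.toReal_one]

lemma tsum_toReal_mul_nonneg {α : Type*} (p : PMF α) (g : α → ℝ) (h0 : ∀ a, 0 ≤ g a) :
    0 ≤ ∑' a, (p a).toReal * g a :=
  tsum_nonneg fun a => mul_nonneg ENNReal.toReal_nonneg (h0 a)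

lemma tsum_toReal_mul_le {α : Type*} (p : PMF α) (g : α → ℝ) {C : ℝ}
    (h0 : ∀ a, 0 ≤ g a) (hC : ∀ a, g a ≤ C) : ∑' a, (p a).toReal * g a ≤ C := by
  have hp : Summable fun a => (p a).toReal := ENNReal.summable_toReal p.tsum_coe_ne_top
  refine ((summable_toReal_mul p g h0 hC).tsum_le_tsum (fun a =>
    mul_le_mul_of_nonneg_left (hC a) ENNReal.toReal_nonneg) (hp.mul_right C)).trans ?_
  rw [tsum_mul_right, tsum_toReal_eq_one, one_mul]

lemma mul_toOuterMeasure_le_tsum_toReal_mul {α : Type*} (p : PMF α) (g : α → ℝ) {C v : ℝ}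
    (h0 : ∀ a, 0 ≤ g a) (hC : ∀ a, g a ≤ C) :
    v * (p.toOuterMeasure {a | v ≤ g a}).toReal ≤ ∑' a, (p a).toReal * g a := by
  have hp : Summable fun a => (p a).toReal := ENNReal.summable_toReal p.tsum_coe_ne_top
  have hind (a : α) : ({a | v ≤ g a}.indicator p a).toReal =
      {a | v ≤ g a}.indicator (fun a => (p a).toReal) a := by
    by_cases ha : a ∈ {a | v ≤ g a} <;> simp [ha]
  rw [PMF.toOuterMeasure_apply, ENNReal.tsum_toReal_eq fun a => ?_, ← tsum_mul_left]
  · simp only [hind]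
    refine ((hp.indicator _).mul_left v).tsum_le_tsum (fun a => ?_)
      (summable_toReal_mul p g h0 hC)
    by_cases ha : a ∈ {a | v ≤ g a}
    · rw [Set.indicator_of_mem ha, mul_comm]
      exact mul_le_mul_of_nonneg_left ha ENNReal.toReal_nonneg
    · rw [Set.indicator_of_notMem ha, mul_zero]
      exact mul_nonneg ENNReal.toReal_nonneg (h0 a)
  · by_cases ha : a ∈ {a | v ≤ g a}
    · rw [Set.indicator_of_mem ha]
      exact p.apply_ne_top a
    · simp [ha]

end PMFSums

/-! ### Dependence on finitely many states. -/

section InitialSegments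

/-- Such a function factors through the finite discrete space of paths of length `T`. -/
lemma measurable_of_eq_on_initial {Ω β : Type*} [Finite Ω] [Nonempty Ω] [MeasurableSpace Ω]
    [DiscreteMeasurableSpace Ω] [MeasurableSpace β] (T : ℕ) (Φ : (ℕ → Ω) → β)
    (h : ∀ ω ω', (∀ s < T, ω s = ω' s) → Φ ω = Φ ω') : Measurable Φ := by
  classical
  let x₀ : Ω := Classical.arbitrary Ω
  let ext : (Fin T → Ω) → (ℕ → Ω) := fun z s => if hs : s < T then z ⟨s, hs⟩ else x₀
  let res : (ℕ → Ω) → (Fin T → Ω) := fun ω s => ω s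
  have hres : Measurable res := measurable_pi_lambda _ fun s => measurable_pi_apply _
  have : Φ = (Φ ∘ ext) ∘ res := by
    funext ω
    exact h _ _ fun s hs => by simp [ext, res, hs]
  rw [this]
  exact (measurable_of_countable _).comp hres

variable {Ω A : Type*} [Fintype Ω]

lemma playLaw_congr (σ : SenderStrategy Ω) (ρ : ReceiverAlgorithm Ω A) {ω ω' : ℕ → Ω} {T : ℕ}
    (h : ∀ s < T, ω s = ω' s) : playLaw σ ρ ω T = playLaw σ ρ ω' T := by
  induction T with
  | zero => rfl
  | succ T ih =>
    rw [playLaw, playLaw, ih fun s hs => h s (hs.trans (Nat.lt_succ_self T)),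
      h T (Nat.lt_succ_self T)]

end InitialSegments

/-! ### Play against a deterministic sender, path by path. -/

section PureSender

variable {Ω A : Type*} [Fintype Ω]

/-- The forecasts and states that a deterministic sender generates along a path of states. -/
def forecastPath (s : List (stdSimplex ℝ Ω × Ω) → stdSimplex ℝ Ω) (ω : ℕ → Ω) :
    ℕ → List (stdSimplex ℝ Ω × Ω)
  | 0 => []
  | t + 1 => (s (forecastPath s ω t), ω t) :: forecastPath s ω t

/-- The part of a history that the sender uses. -/
def publicPart (h : List (Round Ω A)) : List (stdSimplex ℝ Ω × Ω) :=
  h.map fun r => (r.forecast, r.state)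

lemma length_forecastPath (s : List (stdSimplex ℝ Ω × Ω) → stdSimplex ℝ Ω) (ω : ℕ → Ω) (t : ℕ) :
    (forecastPath s ω t).length = t := by
  induction t with
  | zero => rfl
  | succ t ih => simp [forecastPath, ih]

lemma length_of_publicPart {s : List (stdSimplex ℝ Ω × Ω) → stdSimplex ℝ Ω} {ω : ℕ → Ω} {t : ℕ}
    {h : List (Round Ω A)} (hh : publicPart h = forecastPath s ω t) : h.length = t := by
  rw [← length_forecastPath s ω t, ← hh, publicPart, List.length_map]

lemma publicPart_eq_of_mem_support (s : List (stdSimplex ℝ Ω × Ω) → stdSimplex ℝ Ω)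
    (ρ : ReceiverAlgorithm Ω A) (ω : ℕ → Ω) (t : ℕ) (h : List (Round Ω A))
    (hh : h ∈ (playLaw (fun l => PMF.pure (s l)) ρ ω t).support) :
    publicPart h = forecastPath s ω t := by
  induction t generalizing h with
  | zero =>
    rw [playLaw, PMF.support_pure, Set.mem_singleton_iff] at hh
    rw [hh]; rfl
  | succ t ih =>
    simp only [playLaw, PMF.pure_bind, PMF.mem_support_bind_iff, PMF.mem_support_map_iff] at hh
    obtain ⟨h', hh', a, -, rfl⟩ := hh
    have := ih h' hh'
    simp only [publicPart] at this
    simp only [publicPart, List.map_cons, this, forecastPath]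

lemma cumulativePayoff_eq_sum (uR : Ω → A → ℝ)
    (s : List (stdSimplex ℝ Ω × Ω) → stdSimplex ℝ Ω) (ω : ℕ → Ω) (t : ℕ) (h : List (Round Ω A))
    (hh : publicPart h = forecastPath s ω t) (f : stdSimplex ℝ Ω) (a : A)
    [DecidableEq (stdSimplex ℝ Ω)] :
    cumulativePayoff uR h f a =
      ∑ i ∈ Finset.range t, if s (forecastPath s ω i) = f then uR (ω i) a else 0 := by
  induction t generalizing h with
  | zero =>
    have : h = [] := by simpa [publicPart, forecastPath] using hh
    simp [this, cumulativePayoff]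
  | succ t ih =>
    cases h with
    | nil => simp [publicPart, forecastPath] at hh
    | cons r h =>
      simp only [publicPart, forecastPath, List.map_cons, List.cons.injEq, Prod.mk.injEq] at hh
      obtain ⟨⟨h1, h2⟩, h3⟩ := hh
      rw [Finset.sum_range_succ, ← ih h h3]
      simp only [cumulativePayoff, List.filter_cons]
      by_cases hf : s (forecastPath s ω t) = f
      · simp [h1, h2, hf, add_comm]
      · simp [h1, hf]

/-- The sum of the costs of the actions taken in a history, where `c t a` is the cost of the
action `a` in period `t`. -/
def totalCost (c : ℕ → A → ENNReal) : List (Round Ω A) → ENNReal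
  | [] => 0
  | r :: h => totalCost c h + c h.length r.action

/-- The hypothesis bounds the conditional expected cost of each period at every history with the
right public part, and expectations add over periods. -/
lemma expected_totalCost_le (s : List (stdSimplex ℝ Ω × Ω) → stdSimplex ℝ Ω)
    (ρ : ReceiverAlgorithm Ω A) (ω : ℕ → Ω) (c : ℕ → A → ENNReal) (e : ENNReal) (T : ℕ)
    (hc : ∀ t < T, ∀ h : List (Round Ω A), publicPart h = forecastPath s ω t →
      ∑' a, ρ h (s (forecastPath s ω t)) a * c t a ≤ e) :
    ∑' h, playLaw (fun l => PMF.pure (s l)) ρ ω T h * totalCost c h ≤ T * e := by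
  induction T with
  | zero => simp [playLaw, totalCost]
  | succ T ih =>
    have ih := ih fun t ht => hc t (ht.trans (Nat.lt_succ_self T))
    simp only [playLaw, PMF.pure_bind]
    rw [tsum_bind_mul]
    set p := playLaw (fun l => PMF.pure (s l)) ρ ω T
    have hstep : ∀ h, p h * ∑' b, ((ρ h (s (publicPart h))).map
        fun a => (⟨s (publicPart h), a, ω T⟩ : Round Ω A) :: h) b * totalCost c b ≤
        p h * totalCost c h + p h * e := by
      intro h
      by_cases hh : h ∈ p.support
      · have hp := publicPart_eq_of_mem_support s ρ ω T h hh
        rw [tsum_map_mul, ← mul_add]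
        gcongr
        simp only [totalCost, mul_add, ENNReal.tsum_add, length_of_publicPart hp]
        rw [ENNReal.tsum_mul_right, PMF.tsum_coe, one_mul, hp]
        gcongr
        exact hc T (Nat.lt_succ_self T) h hp
      · simp [(PMF.apply_eq_zero_iff p h).2 hh]
    refine (ENNReal.tsum_le_tsum hstep).trans ?_
    rw [ENNReal.tsum_add, ENNReal.tsum_mul_right, PMF.tsum_coe, one_mul]
    push_cast
    rw [add_mul, one_mul]
    gcongr

/-- The shortfall of the realized payoff from the benchmark `w` is at most the total cost, when the
cost of an action is the shortfall in its period. -/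
lemma ofReal_sub_payoff_le_totalCost (u : Ω → A → ℝ)
    (s : List (stdSimplex ℝ Ω × Ω) → stdSimplex ℝ Ω) (ω : ℕ → Ω) (w : ℕ → ℝ) (T : ℕ)
    (h : List (Round Ω A)) (hh : publicPart h = forecastPath s ω T) :
    ENNReal.ofReal (∑ t ∈ Finset.range T, w t - (h.map fun r => u r.state r.action).sum) ≤
      totalCost (fun t a => ENNReal.ofReal (w t - u (ω t) a)) h := by
  induction T generalizing h with
  | zero =>
    have : h = [] := by simpa [publicPart, forecastPath] using hh
    simp [this]
  | succ T ih =>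
    cases h with
    | nil => simp [publicPart, forecastPath] at hh
    | cons r h =>
      simp only [publicPart, forecastPath, List.map_cons, List.cons.injEq, Prod.mk.injEq] at hh
      obtain ⟨⟨-, h2⟩, h3⟩ := hh
      have hlen : h.length = T := length_of_publicPart h3
      rw [Finset.sum_range_succ, List.map_cons, List.sum_cons, totalCost, hlen, h2,
        show ∀ a b c d : ℝ, a + b - (c + d) = (a - d) + (b - c) by intros; ring]
      exact ENNReal.ofReal_add_le.trans (add_le_add_left (ih h h3) _)

/-- Markov's inequality: an average below `v` forces a total cost of at least `δ`. -/
lemma toOuterMeasure_averagePayoff_lt_le [MeasurableSpace Ω] (G : Game Ω A)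
    (s : List (stdSimplex ℝ Ω × Ω) → stdSimplex ℝ Ω)
    (ρ : ReceiverAlgorithm Ω A) (ω : ℕ → Ω) (w : ℕ → ℝ) (e : ENNReal) {T : ℕ} (hT : 0 < T)
    (hc : ∀ t < T, ∀ h : List (Round Ω A), publicPart h = forecastPath s ω t →
      ∑' a, ρ h (s (forecastPath s ω t)) a * ENNReal.ofReal (w t - G.uS (ω t) a) ≤ e)
    {v δ : ℝ} (hδ : 0 < δ) (hv : v * T ≤ ∑ t ∈ Finset.range T, w t - δ) :
    (playLaw (fun l => PMF.pure (s l)) ρ ω T).toOuterMeasure {h | v ≤ G.averagePayoff h}ᶜ ≤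
      T * e / ENNReal.ofReal δ := by
  rw [ENNReal.le_div_iff_mul_le (.inl (by simpa using hδ)) (.inl ENNReal.ofReal_ne_top)]
  refine (toOuterMeasure_mul_le_tsum _ _ _ _ fun h hh hlt => ?_).trans
    (expected_totalCost_le s ρ ω _ e T hc)
  have hp := publicPart_eq_of_mem_support s ρ ω T h hh
  refine (ENNReal.ofReal_le_ofReal ?_).trans (ofReal_sub_payoff_le_totalCost G.uS s ω w T h hp)
  have hT' : (0 : ℝ) < T := by exact_mod_cast hT
  have : G.averagePayoff h < v := not_le.1 hlt
  rw [Game.averagePayoff, length_of_publicPart hp, div_lt_iff₀ hT'] at this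
  linarith

end PureSender

/-! ### The label-swapping strategy and its guarantee. -/

section ExampleStrategy

/-- The state before the current period, with the convention that the state before the first
period is `0`. -/
def previousState : List (stdSimplex ℝ (Fin 2) × Fin 2) → Fin 2
  | [] => 0
  | r :: _ => r.2

/-- The state before period `t` along a path. -/
def stateBefore (ω : ℕ → Fin 2) : ℕ → Fin 2
  | 0 => 0
  | t + 1 => ω t

/-- In the first half of the game the label is the previous state, in the second half it is the
other state. -/
def labelAt (T t : ℕ) (x : Fin 2) : Fin 2 := if 2 * t < T then x else 1 - x

/-- The forecast of the sender: the true conditional in the first half of the game, and the other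
conditional in the second half. -/
def exampleForecast (T : ℕ) (l : List (stdSimplex ℝ (Fin 2) × Fin 2)) : stdSimplex ℝ (Fin 2) :=
  exampleKernel (labelAt T l.length (previousState l))

/-- The label along a path. -/
def pathLabel (T : ℕ) (ω : ℕ → Fin 2) (t : ℕ) : Fin 2 := labelAt T t (stateBefore ω t)

lemma exampleForecast_forecastPath (T : ℕ) (ω : ℕ → Fin 2) (t : ℕ) :
    exampleForecast T (forecastPath (exampleForecast T) ω t) =
      exampleKernel (pathLabel T ω t) := by
  rw [exampleForecast, length_forecastPath, pathLabel]
  cases t <;> rfl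

/-- The number of periods before `t` with label `c` and state `j`. -/
def labelCount (T : ℕ) (ω : ℕ → Fin 2) (c j : Fin 2) (t : ℕ) : ℝ :=
  ∑ s ∈ Finset.range t, if pathLabel T ω s = c ∧ ω s = j then 1 else 0

/-- The number of periods before `t` with previous state `i` and state `j`. -/
def transitionCount (ω : ℕ → Fin 2) (i j : Fin 2) (t : ℕ) : ℝ :=
  ∑ s ∈ Finset.range t, if stateBefore ω s = i ∧ ω s = j then 1 else 0

lemma cumulativePayoff_eq_labelCount {A : Type*} (uR : Fin 2 → A → ℝ) (T : ℕ) (ω : ℕ → Fin 2)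
    (t : ℕ) (h : List (Round (Fin 2) A))
    (hh : publicPart h = forecastPath (exampleForecast T) ω t) (c : Fin 2) (a : A) :
    cumulativePayoff uR h (exampleKernel c) a =
      labelCount T ω c 0 t * uR 0 a + labelCount T ω c 1 t * uR 1 a := by
  classical
  rw [cumulativePayoff_eq_sum uR _ ω t h hh]
  simp only [labelCount, Finset.sum_mul, ← Finset.sum_add_distrib, exampleForecast_forecastPath,
    exampleKernel_injective.eq_iff]
  refine Finset.sum_congr rfl fun s _ => ?_
  generalize ω s = x
  by_cases hl : pathLabel T ω s = c <;> fin_cases x <;> simp [hl]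

/-- The count stops before `t`, hence the slack of one in `ht`. -/
lemma labelCount_of_first_half (T : ℕ) (ω : ℕ → Fin 2) (c j : Fin 2) {t : ℕ}
    (ht : 2 * t ≤ T + 1) : labelCount T ω c j t = transitionCount ω c j t := by
  refine Finset.sum_congr rfl fun s hs => ?_
  have : 2 * s < T := by have := Finset.mem_range.1 hs; omega
  simp [pathLabel, labelAt, this]

lemma labelCount_of_second_half (T : ℕ) (ω : ℕ → Fin 2) (c j : Fin 2) {h t : ℕ}
    (h1 : T ≤ 2 * h) (h2 : 2 * h ≤ T + 1) (ht : h ≤ t) :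
    labelCount T ω c j t = transitionCount ω c j h +
      (transitionCount ω (1 - c) j t - transitionCount ω (1 - c) j h) := by
  induction t, ht using Nat.le_induction with
  | base => rw [labelCount_of_first_half T ω c j h2, sub_self, add_zero]
  | succ t ht ih =>
    rw [labelCount, Finset.sum_range_succ, ← labelCount, ih,
      show transitionCount ω (1 - c) j (t + 1) = transitionCount ω (1 - c) j t +
        if stateBefore ω t = 1 - c ∧ ω t = j then 1 else 0 from Finset.sum_range_succ _ _]
    have h3 : ¬ 2 * t < T := by omega
    have h4 : (pathLabel T ω t = c) ↔ (stateBefore ω t = 1 - c) := by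
      simp only [pathLabel, labelAt, h3, if_false]
      have hflip : ∀ x c : Fin 2, 1 - x = c ↔ x = 1 - c := by decide
      exact hflip _ _
    simp only [h4]
    ring

/-- The transition counts up to each `t ≤ T` are within `η T` of their stationary means. -/
def IsNearStationary (ω : ℕ → Fin 2) (η : ℝ) (T : ℕ) : Prop :=
  ∀ i j, ∀ t ≤ T, |transitionCount ω i j t - (if i = j then 2 / 5 else 1 / 10) * t| ≤ η * T

/-- Uniformity in `t`: the finitely many early times have bounded deviation, which `η * T`
eventually exceeds. -/
lemma eventually_forall_le_abs_sub_le {x : ℕ → ℝ} {l : ℝ}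
    (hx : Tendsto (fun n : ℕ => x n / n) atTop (𝓝 l)) (h0 : x 0 = 0) {η : ℝ} (hη : 0 < η) :
    ∀ᶠ T : ℕ in atTop, ∀ t ≤ T, |x t - l * t| ≤ η * T := by
  obtain ⟨N, hN⟩ := Metric.tendsto_atTop.1 hx η hη
  have hlarge : ∀ t ≥ N, |x t - l * t| ≤ η * t := fun t ht => by
    rcases Nat.eq_zero_or_pos t with rfl | hpos
    · simp [h0]
    · have h1 := (hN t ht).le
      have hpos' : (0 : ℝ) < t := by exact_mod_cast hpos
      rw [Real.dist_eq] at h1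
      have h2 : x t - l * t = (x t / t - l) * t := by field_simp
      rw [h2, abs_mul, Nat.abs_cast]
      gcongr
  set M := ∑ t ∈ Finset.range N, |x t - l * t|
  have hsmall : ∀ t < N, |x t - l * t| ≤ M := fun t ht =>
    Finset.single_le_sum (f := fun t : ℕ => |x t - l * t|) (fun _ _ => abs_nonneg _)
      (Finset.mem_range.2 ht)
  have hM : ∀ᶠ T : ℕ in atTop, M ≤ η * T :=
    (tendsto_natCast_atTop_atTop.const_mul_atTop hη).eventually_ge_atTop M
  filter_upwards [hM] with T hT t ht
  rcases lt_or_ge t N with h | h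
  · exact (hsmall t h).trans hT
  · exact (hlarge t h).trans (by gcongr)

lemma IsTypicalPath.eventually_isNearStationary {ω : ℕ → Fin 2} (hω : IsTypicalPath ω) {η : ℝ}
    (hη : 0 < η) : ∀ᶠ T : ℕ in atTop, IsNearStationary ω η T := by
  simp only [IsNearStationary, eventually_all]
  intro i j
  exact eventually_forall_le_abs_sub_le (x := transitionCount ω i j)
    (tendsto_average_of_shift (fun t => rfl) (hω i j)) (by simp [transitionCount]) hη

/-- The action that is eventually optimal for the receiver in period `t` when the label is `c`. -/
def leadingAction (T t : ℕ) (c : Fin 2) : Fin 4 :=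
  if 11 * t < 6 * T then ![0, 3] c else ![1, 2] c

/-- The extreme action beats the adjacent moderate one by x - 3y ≈ t/10. The sign of y extends the
comparison to the other two actions. -/
lemma margin_first_half {ω : ℕ → Fin 2} {T t : ℕ} {δ : ℝ}
    (hδ : 0 < δ) (hω : IsNearStationary ω (δ / 1000) T) (htT : t ≤ T)
    (hlow : δ * T ≤ t) (hhalf : 2 * t ≤ T + 1) (c : Fin 2) :
    δ * T / 20 ≤ labelCount T ω c c t - 3 * labelCount T ω c (1 - c) t ∧
    0 ≤ labelCount T ω c (1 - c) t := by
  have h1 := abs_le.1 (hω c c t htT)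
  have h2 := abs_le.1 (hω c (1 - c) t htT)
  have hc : ∀ c : Fin 2, c ≠ 1 - c := by decide
  rw [if_neg (hc c)] at h2
  rw [if_pos rfl] at h1
  have hT : 0 ≤ (T : ℝ) := T.cast_nonneg
  have hp := mul_nonneg hδ.le hT
  rw [labelCount_of_first_half T ω c c hhalf, labelCount_of_first_half T ω c (1 - c) hhalf]
  exact ⟨by linarith, by linarith⟩

lemma labelCount_second_half_bounds {ω : ℕ → Fin 2} {T t : ℕ} {η : ℝ}
    (hω : IsNearStationary ω η T) (htT : t ≤ T)
    (hhalf : T ≤ 2 * t) (c : Fin 2) :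
    |labelCount T ω c c t - (3 / 20 * T + 1 / 10 * t)| ≤ 3 * (η * T) + 1 ∧
    |labelCount T ω c (1 - c) t - (2 / 5 * t - 3 / 20 * T)| ≤ 3 * (η * T) + 1 := by
  -- `h` is T/2 rounded up, the first period with swapped labels; the rounding accounts for the `+
  -- 1` in the bounds.
  obtain ⟨h, hh1, hh2⟩ : ∃ h, T ≤ 2 * h ∧ 2 * h ≤ T + 1 := ⟨(T + 1) / 2, by omega, by omega⟩
  have hht : h ≤ t := by omega
  have hr1 : (T : ℝ) ≤ 2 * h := by exact_mod_cast hh1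
  have hr2 : 2 * (h : ℝ) ≤ T + 1 := by exact_mod_cast hh2
  have hc : c ≠ 1 - c := by revert c; decide
  have a1 := abs_le.1 (hω c c h (hht.trans htT))
  have a2 := abs_le.1 (hω (1 - c) c h (hht.trans htT))
  have a3 := abs_le.1 (hω (1 - c) c t htT)
  have b1 := abs_le.1 (hω c (1 - c) h (hht.trans htT))
  have b2 := abs_le.1 (hω (1 - c) (1 - c) h (hht.trans htT))
  have b3 := abs_le.1 (hω (1 - c) (1 - c) t htT)
  rw [if_pos rfl] at a1 b2 b3
  rw [if_neg hc] at b1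
  rw [if_neg hc.symm] at a2 a3
  rw [labelCount_of_second_half T ω c c hh1 hh2 hht,
    labelCount_of_second_half T ω c (1 - c) hh1 hh2 hht, abs_le, abs_le]
  refine ⟨⟨?_, ?_⟩, ?_, ?_⟩ <;> linarith

/-- Away from the times `0`, `6 T / 11` and `T`, the leading action is ahead of all other actions by
a margin of order `T`. -/
lemma leadingAction_margin {ω : ℕ → Fin 2} {T t : ℕ} {δ : ℝ}
    (hδ : 0 < δ) (hδ1 : δ ≤ 1 / 22) (hω : IsNearStationary ω (δ / 1000) T) (htT : t ≤ T)
    (hT : 1000 ≤ δ * T)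
    (ht : (δ * T ≤ t ∧ t ≤ (6 / 11 - δ) * T) ∨ ((6 / 11 + δ) * T ≤ t ∧ t ≤ (1 - δ) * T))
    (c : Fin 2) (b : Fin 4) (hb : b ≠ leadingAction T t c) :
    labelCount T ω c 0 t * exampleGame.uR 0 b + labelCount T ω c 1 t * exampleGame.uR 1 b +
        δ * T / 20 ≤
      labelCount T ω c 0 t * exampleGame.uR 0 (leadingAction T t c) +
        labelCount T ω c 1 t * exampleGame.uR 1 (leadingAction T t c) := by
  have hTp : (0 : ℝ) ≤ T := T.cast_nonneg
  have hδT : δ * T ≤ 1 / 22 * T := by gcongr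
  by_cases hphase : 11 * t < 6 * T
  · have hphaseR : 11 * (t : ℝ) < 6 * T := by exact_mod_cast hphase
    have ht : δ * T ≤ t ∧ t ≤ (6 / 11 - δ) * T := by
      refine ht.resolve_right fun h => ?_
      linarith [h.1]
    have key : δ * T / 20 ≤ labelCount T ω c c t - 3 * labelCount T ω c (1 - c) t ∧
        0 ≤ labelCount T ω c (1 - c) t := by
      by_cases hhalf : 2 * t ≤ T + 1
      · exact margin_first_half hδ hω htT ht.1 hhalf c
      -- Here x - 3y ≈ 3T/5 - 11t/10, which vanishes at 6T/11.
      · have hhalf' : T ≤ 2 * t := by omega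
        have hhalfR : (T : ℝ) ≤ 2 * t := by exact_mod_cast hhalf'
        obtain ⟨h1, h2⟩ := labelCount_second_half_bounds hω htT hhalf' c
        rw [abs_le] at h1 h2
        constructor <;> linarith
    obtain ⟨k1, k2⟩ := key
    simp only [leadingAction, hphase, if_true] at hb ⊢
    fin_cases c <;> fin_cases b <;> simp [exampleGame] at hb k1 k2 ⊢ <;> linarith
  · have hphase' : 6 * T ≤ 11 * t := by omega
    have hphaseR : 6 * (T : ℝ) ≤ 11 * t := by exact_mod_cast hphase'
    have ht : (6 / 11 + δ) * T ≤ t ∧ t ≤ (1 - δ) * T := by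
      refine ht.resolve_left fun h => ?_
      linarith [h.2]
    have hhalf' : T ≤ 2 * t := by omega
    -- Now 3y - x is positive, and x - y ≈ 3(T - t)/10 keeps the moderate action ahead of its mirror
    -- image.
    obtain ⟨h1, h2⟩ := labelCount_second_half_bounds hω htT hhalf' c
    rw [abs_le] at h1 h2
    simp only [leadingAction, hphase, if_false] at hb ⊢
    fin_cases c <;> fin_cases b <;> simp [exampleGame] at hb h1 h2 ⊢ <;> linarith

/-- The benchmark payoff of period `t`: the payoff that the sender gets from the leading action on
the two blocks of periods `[a₁, b₁)` and `[a₂, b₂)`, and zero elsewhere. -/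
def benchmark (ω : ℕ → Fin 2) (a₁ b₁ a₂ b₂ t : ℕ) : ℝ :=
  (if t ∈ Finset.Ico a₁ b₁ then 2 else 0) +
    (if t ∈ Finset.Ico a₂ b₂ then if stateBefore ω t = ω t then 4 else 0 else 0)

lemma sum_benchmark (ω : ℕ → Fin 2) {a₁ b₁ a₂ b₂ T : ℕ} (h1 : a₁ ≤ b₁) (h1T : b₁ ≤ T)
    (h2 : a₂ ≤ b₂) (h2T : b₂ ≤ T) :
    ∑ t ∈ Finset.range T, benchmark ω a₁ b₁ a₂ b₂ t = 2 * ((b₁ : ℝ) - a₁) +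
      4 * (transitionCount ω 0 0 b₂ + transitionCount ω 1 1 b₂ -
        (transitionCount ω 0 0 a₂ + transitionCount ω 1 1 a₂)) := by
  have hstay (n : ℕ) : ∑ t ∈ Finset.range n, (if stateBefore ω t = ω t then (4 : ℝ) else 0) =
      4 * (transitionCount ω 0 0 n + transitionCount ω 1 1 n) := by
    rw [transitionCount, transitionCount, ← Finset.sum_add_distrib, Finset.mul_sum]
    refine Finset.sum_congr rfl fun t _ => ?_
    generalize stateBefore ω t = x
    generalize ω t = y
    fin_cases x <;> fin_cases y <;> simp
  have hsub {a b : ℕ} (hb : b ≤ T) : Finset.range T ∩ Finset.Ico a b = Finset.Ico a b :=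
    Finset.inter_eq_right.2 fun t ht =>
      Finset.mem_range.2 ((Finset.mem_Ico.1 ht).2.trans_le hb)
  simp only [benchmark]
  rw [Finset.sum_add_distrib, Finset.sum_ite_mem, Finset.sum_ite_mem, hsub h1T, hsub h2T,
    Finset.sum_const, Nat.card_Ico, Finset.sum_Ico_eq_sub _ h2, hstay, hstay, nsmul_eq_mul,
    Nat.cast_sub h1]
  ring

lemma exampleGame_uS_nonneg (x : Fin 2) (a : Fin 4) : 0 ≤ exampleGame.uS x a := by
  fin_cases x <;> fin_cases a <;> simp [exampleGame]

lemma exampleGame_uS_le (x : Fin 2) (a : Fin 4) : exampleGame.uS x a ≤ 4 := by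
  fin_cases x <;> fin_cases a <;> simp [exampleGame] <;> norm_num

lemma benchmark_le_four (ω : ℕ → Fin 2) {a₁ b₁ a₂ b₂ : ℕ} (h : b₁ ≤ a₂) (t : ℕ) :
    benchmark ω a₁ b₁ a₂ b₂ t ≤ 4 := by
  by_cases h1 : t ∈ Finset.Ico a₁ b₁
  · have h2 : t ∉ Finset.Ico a₂ b₂ := by
      rw [Finset.mem_Ico] at h1 ⊢; omega
    simp only [benchmark, h1, h2, if_true, if_false]
    norm_num
  · simp only [benchmark, h1, if_false]
    split_ifs <;> norm_num

lemma uS_leadingAction_of_early (ω : ℕ → Fin 2) {T t : ℕ} (ht : 11 * t < 6 * T) (c : Fin 2) :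
    exampleGame.uS (ω t) (leadingAction T t c) = 2 := by
  simp only [leadingAction, ht, if_true]
  generalize ω t = x
  fin_cases x <;> fin_cases c <;> simp [exampleGame]

lemma uS_leadingAction_of_late (ω : ℕ → Fin 2) {T t : ℕ} (ht : 6 * T ≤ 11 * t) :
    exampleGame.uS (ω t) (leadingAction T t (pathLabel T ω t)) =
      if stateBefore ω t = ω t then 4 else 0 := by
  have h1 : ¬ 11 * t < 6 * T := by omega
  have h2 : ¬ 2 * t < T := by omega
  simp only [leadingAction, h1, pathLabel, labelAt, h2, if_false]
  generalize ω t = x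
  generalize stateBefore ω t = y
  fin_cases x <;> fin_cases y <;> simp [exampleGame]

/-- Inside the blocks the leading action costs nothing, and each other action has probability at
most `γ` because `γ * T` is below the margin `δ * T / 20`. The 16 is four actions times the maximal
shortfall 4. -/
lemma benchmark_cost_le {ω : ℕ → Fin 2} {T : ℕ} {δ γ : ℝ}
    (hδ : 0 < δ) (hδ1 : δ ≤ 1 / 22) (hω : IsNearStationary ω (δ / 1000) T)
    (hT : 1000 ≤ δ * T) (hγ : γ < δ / 20) {a₁ b₁ a₂ b₂ : ℕ}
    (ha₁ : δ * T ≤ a₁) (hb₁ : b₁ ≤ (6 / 11 - δ) * T)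
    (ha₂ : (6 / 11 + δ) * T ≤ a₂) (hb₂ : b₂ ≤ (1 - δ) * T) (hba : b₁ ≤ a₂)
    (ρ : ReceiverAlgorithm (Fin 2) (Fin 4)) (hρ : IsMeanBasedWith exampleGame.uR γ T ρ)
    {t : ℕ} (ht : t < T) (h : List (Round (Fin 2) (Fin 4)))
    (hh : publicPart h = forecastPath (exampleForecast T) ω t) :
    ∑' a, ρ h (exampleForecast T (forecastPath (exampleForecast T) ω t)) a *
      ENNReal.ofReal (benchmark ω a₁ b₁ a₂ b₂ t - exampleGame.uS (ω t) a) ≤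
        16 * ENNReal.ofReal γ := by
  have hTpos : (0 : ℝ) < T := by exact_mod_cast (Nat.zero_le t).trans_lt ht
  rw [exampleForecast_forecastPath, tsum_fintype]
  set c := pathLabel T ω t with hc
  have key : ∀ a ∈ (Finset.univ : Finset (Fin 4)), ρ h (exampleKernel c) a *
      ENNReal.ofReal (benchmark ω a₁ b₁ a₂ b₂ t - exampleGame.uS (ω t) a) ≤
        ENNReal.ofReal γ * 4 := by
    intro a _
    by_cases hblock : t ∈ Finset.Ico a₁ b₁ ∨ t ∈ Finset.Ico a₂ b₂
    · have htime : (δ * T ≤ t ∧ t ≤ (6 / 11 - δ) * T) ∨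
          ((6 / 11 + δ) * T ≤ t ∧ t ≤ (1 - δ) * T) := by
        rcases hblock with h | h <;> rw [Finset.mem_Ico] at h
        · have h1 : (a₁ : ℝ) ≤ t := by exact_mod_cast h.1
          have h2 : (t : ℝ) ≤ b₁ := by exact_mod_cast h.2.le
          exact .inl ⟨ha₁.trans h1, h2.trans hb₁⟩
        · have h1 : (a₂ : ℝ) ≤ t := by exact_mod_cast h.1
          have h2 : (t : ℝ) ≤ b₂ := by exact_mod_cast h.2.le
          exact .inr ⟨ha₂.trans h1, h2.trans hb₂⟩
      by_cases ha : a = leadingAction T t c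
      · have hle : benchmark ω a₁ b₁ a₂ b₂ t - exampleGame.uS (ω t) a ≤ 0 := by
          rw [sub_nonpos, ha]
          rcases hblock with h | h
          · have h2 : t ∉ Finset.Ico a₂ b₂ := by
              rw [Finset.mem_Ico] at h ⊢; omega
            have hlt : (t : ℝ) < b₁ := by exact_mod_cast (Finset.mem_Ico.1 h).2
            have hearly : 11 * (t : ℝ) < 6 * T := by nlinarith
            rw [uS_leadingAction_of_early ω (by exact_mod_cast hearly)]
            simp [benchmark, h, h2]
          · have h2 : t ∉ Finset.Ico a₁ b₁ := by
              rw [Finset.mem_Ico] at h ⊢; omega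
            have hge : (a₂ : ℝ) ≤ t := by exact_mod_cast (Finset.mem_Ico.1 h).1
            have hlate : 6 * (T : ℝ) ≤ 11 * t := by nlinarith
            rw [hc, uS_leadingAction_of_late ω (by exact_mod_cast hlate)]
            simp only [benchmark, h, h2, if_true, if_false, zero_add, le_refl]
        rw [ENNReal.ofReal_of_nonpos hle, mul_zero]
        exact zero_le
      · have hm := leadingAction_margin hδ hδ1 hω ht.le hT htime c a ha
        have hprob : (ρ h (exampleKernel c) a).toReal ≤ γ := by
          refine hρ h (by rw [length_of_publicPart hh]; exact ht) _ a ⟨leadingAction T t c, ?_⟩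
          rw [cumulativePayoff_eq_labelCount _ T ω t h hh,
            cumulativePayoff_eq_labelCount _ T ω t h hh]
          have : γ * T < δ / 20 * T := by gcongr
          linarith
        gcongr
        · rw [← ENNReal.ofReal_toReal (PMF.apply_ne_top _ a)]
          exact ENNReal.ofReal_le_ofReal hprob
        · rw [← ENNReal.ofReal_ofNat 4]
          refine ENNReal.ofReal_le_ofReal ?_
          linarith [benchmark_le_four ω (a₁ := a₁) (b₂ := b₂) hba t,
            exampleGame_uS_nonneg (ω t) a]
    · rw [not_or] at hblock
      have : benchmark ω a₁ b₁ a₂ b₂ t = 0 := by simp only [benchmark, hblock, if_false, add_zero]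
      rw [this, zero_sub, ENNReal.ofReal_of_nonpos
        (neg_nonpos.2 (exampleGame_uS_nonneg _ _)), mul_zero]
      exact zero_le
  refine (Finset.sum_le_card_nsmul _ _ _ key).trans (le_of_eq ?_)
  rw [Finset.card_univ, Fintype.card_fin, nsmul_eq_mul]
  push_cast
  ring

/-- Each block loses length about 2δT, at rates 2 and 16/5, so about 10.4 δT in all; 12 leaves room
for rounding and for fluctuations of the counts. -/
lemma exists_blocks {ω : ℕ → Fin 2} {T : ℕ} {δ : ℝ} (hδ : 0 < δ) (hδ1 : δ ≤ 1 / 22)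
    (hω : IsNearStationary ω (δ / 1000) T) (hT : 1000 ≤ δ * T) :
    ∃ a₁ b₁ a₂ b₂ : ℕ, δ * T ≤ a₁ ∧ b₁ ≤ (6 / 11 - δ) * T ∧ (6 / 11 + δ) * T ≤ a₂ ∧
      b₂ ≤ (1 - δ) * T ∧ b₁ ≤ a₂ ∧
      (28 / 11 - 12 * δ) * T ≤ ∑ t ∈ Finset.range T, benchmark ω a₁ b₁ a₂ b₂ t := by
  have hTp : (0 : ℝ) ≤ T := T.cast_nonneg
  have hδT : δ * T ≤ 1 / 22 * T := by gcongr
  have p1 : 0 ≤ (6 / 11 - δ) * T := by linarith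
  have p2 : 0 ≤ (6 / 11 + δ) * T := by linarith
  have p3 : 0 ≤ (1 - δ) * T := by linarith
  have a1l := Nat.le_ceil (δ * T)
  have a1u := Nat.ceil_lt_add_one (hδ.le.trans (by linarith) : 0 ≤ δ * T)
  have b1u := Nat.floor_le p1
  have b1l := Nat.lt_floor_add_one ((6 / 11 - δ) * T)
  have a2l := Nat.le_ceil ((6 / 11 + δ) * T)
  have a2u := Nat.ceil_lt_add_one p2
  have b2u := Nat.floor_le p3
  have b2l := Nat.lt_floor_add_one ((1 - δ) * T)
  set a₁ := ⌈δ * T⌉₊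
  set b₁ := ⌊(6 / 11 - δ) * T⌋₊
  set a₂ := ⌈(6 / 11 + δ) * T⌉₊
  set b₂ := ⌊(1 - δ) * T⌋₊
  have h1 : a₁ ≤ b₁ := by
    have : (a₁ : ℝ) ≤ b₁ := by linarith
    exact_mod_cast this
  have h12 : b₁ ≤ a₂ := by
    have : (b₁ : ℝ) ≤ a₂ := by linarith
    exact_mod_cast this
  have h2 : a₂ ≤ b₂ := by
    have : (a₂ : ℝ) ≤ b₂ := by linarith
    exact_mod_cast this
  have h2T : b₂ ≤ T := by
    have : (b₂ : ℝ) ≤ T := by linarith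
    exact_mod_cast this
  refine ⟨a₁, b₁, a₂, b₂, a1l, b1u, a2l, b2u, h12, ?_⟩
  rw [sum_benchmark ω h1 (h12.trans (h2.trans h2T)) h2 h2T]
  have e1 := abs_le.1 (hω 0 0 b₂ h2T)
  have e2 := abs_le.1 (hω 1 1 b₂ h2T)
  have e3 := abs_le.1 (hω 0 0 a₂ (h2.trans h2T))
  have e4 := abs_le.1 (hω 1 1 a₂ (h2.trans h2T))
  rw [if_pos rfl] at e1 e2 e3 e4
  linarith

/-- The forecasting strategies of the sender in the example. -/
def exampleStrategy (T : ℕ) : SenderStrategy (Fin 2) := fun l => PMF.pure (exampleForecast T l)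

lemma IsTypicalPath.tendsto_toOuterMeasure {ω : ℕ → Fin 2} (hω : IsTypicalPath ω)
    {ρ : ℕ → ReceiverAlgorithm (Fin 2) (Fin 4)} (hρ : IsMeanBased exampleGame.uR ρ) {ε : ℝ}
    (hε : 0 < ε) :
    Tendsto (fun T => (playLaw (exampleStrategy T) (ρ T) ω T).toOuterMeasure
      {h | 28 / 11 - ε ≤ exampleGame.averagePayoff h}) atTop (𝓝 1) := by
  obtain ⟨γ, hγ, hmb⟩ := hρ
  -- Half of `ε` pays for the gaps around the blocks, the other half is the deviation in Markov's
  -- inequality.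
  obtain ⟨δ, hδ, hδ1, hδε⟩ : ∃ δ : ℝ, 0 < δ ∧ δ ≤ 1 / 22 ∧ 12 * δ ≤ ε / 2 :=
    ⟨min (1 / 22) (ε / 24), by positivity, min_le_left _ _, by
      linarith [min_le_right (1 / 22) (ε / 24)]⟩
  have hcompl : ∀ᶠ T in atTop, (playLaw (exampleStrategy T) (ρ T) ω T).toOuterMeasure
      {h | 28 / 11 - ε ≤ exampleGame.averagePayoff h}ᶜ ≤ ENNReal.ofReal (32 / ε * γ T) := by
    have hlarge : ∀ᶠ T : ℕ in atTop, 1000 ≤ δ * T :=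
      (tendsto_natCast_atTop_atTop.const_mul_atTop hδ).eventually_ge_atTop _
    filter_upwards [hω.eventually_isNearStationary (η := δ / 1000) (by positivity),
      hγ.eventually_lt_const (show 0 < δ / 20 by positivity), hlarge, eventually_gt_atTop 0]
      with T hstat hγT hT hTpos
    have hTR : (0 : ℝ) < T := by exact_mod_cast hTpos
    obtain ⟨a₁, b₁, a₂, b₂, ha₁, hb₁, ha₂, hb₂, hba, hsum⟩ := exists_blocks hδ hδ1 hstat hT
    have hbound := toOuterMeasure_averagePayoff_lt_le exampleGame (exampleForecast T) (ρ T) ω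
      (benchmark ω a₁ b₁ a₂ b₂) (16 * ENNReal.ofReal (γ T)) hTpos
      (fun t ht h hh => benchmark_cost_le hδ hδ1 hstat hT hγT ha₁ hb₁ ha₂ hb₂ hba (ρ T) (hmb T)
        ht h hh) (v := 28 / 11 - ε) (δ := ε / 2 * T) (by positivity) (by
          have : 12 * δ * T ≤ ε / 2 * T := by gcongr
          linarith)
    refine hbound.trans (le_of_eq ?_)
    rw [← ENNReal.ofReal_natCast T, ← ENNReal.ofReal_ofNat 16,
      ← ENNReal.ofReal_mul (by norm_num), ← ENNReal.ofReal_mul (by positivity),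
      ← ENNReal.ofReal_div_of_pos (by positivity)]
    congr 1
    field_simp
    ring
  have hlim : Tendsto (fun T => ENNReal.ofReal (32 / ε * γ T)) atTop (𝓝 0) := by
    have := ENNReal.tendsto_ofReal (hγ.const_mul (32 / ε))
    rwa [mul_zero, ENNReal.ofReal_zero] at this
  have hzero := tendsto_of_tendsto_of_tendsto_of_le_of_le' tendsto_const_nhds hlim
    (Eventually.of_forall fun _ => zero_le) hcompl
  have hone := ENNReal.Tendsto.sub (tendsto_const_nhds (x := (1 : ENNReal))) hzero
    (.inl ENNReal.one_ne_top)
  rw [tsub_zero] at hone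
  refine hone.congr fun T => ?_
  have h := toOuterMeasure_add_compl (playLaw (exampleStrategy T) (ρ T) ω T)
    {h | 28 / 11 - ε ≤ exampleGame.averagePayoff h}
  refine (ENNReal.eq_sub_of_add_eq (fun htop => ?_) h).symm
  rw [htop, add_top] at h
  exact ENNReal.top_ne_one h

lemma averagePayoff_nonneg (h : List (Round (Fin 2) (Fin 4))) :
    0 ≤ exampleGame.averagePayoff h := by
  refine div_nonneg (List.sum_nonneg fun x hx => ?_) (Nat.cast_nonneg _)
  obtain ⟨r, -, rfl⟩ := List.mem_map.1 hx
  exact exampleGame_uS_nonneg _ _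

lemma averagePayoff_le (h : List (Round (Fin 2) (Fin 4))) :
    exampleGame.averagePayoff h ≤ 4 := by
  refine div_le_of_le_mul₀ (Nat.cast_nonneg _) (by norm_num) ?_
  have := List.sum_le_card_nsmul (h.map fun r => exampleGame.uS r.state r.action) 4 fun x hx => by
    obtain ⟨r, -, rfl⟩ := List.mem_map.1 hx
    exact exampleGame_uS_le _ _
  rw [List.length_map, nsmul_eq_mul] at this
  linarith

lemma tendsto_probPayoffGE {ρ : ℕ → ReceiverAlgorithm (Fin 2) (Fin 4)}
    (hρ : IsMeanBased exampleGame.uR ρ) {ε : ℝ} (hε : 0 < ε) :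
    Tendsto (fun T => exampleGame.probPayoffGE (exampleStrategy T) (ρ T) T (28 / 11 - ε)) atTop
      (𝓝 1) := by
  have h := tendsto_lintegral_of_dominated_convergence
    (μ := (exampleGame.law : Measure (ℕ → Fin 2)))
    (F := fun T ω => (playLaw (exampleStrategy T) (ρ T) ω T).toOuterMeasure
      {h | 28 / 11 - ε ≤ exampleGame.averagePayoff h}) (f := fun _ => 1) (fun _ => 1)
    (fun T => measurable_of_eq_on_initial T _ fun ω ω' hωω' => by
      rw [playLaw_congr _ _ hωω'])
    (fun T => ae_of_all _ fun ω => le_self_add.trans_eq (toOuterMeasure_add_compl _ _))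
    (by simp)
    (by filter_upwards [ae_isTypicalPath] with ω hω using hω.tendsto_toOuterMeasure hρ hε)
  rw [lintegral_one, measure_univ] at h
  exact h

/-- Markov's inequality for the nonnegative average payoff, integrated over paths. -/
lemma mul_probPayoffGE_le_expectedPayoff (σ : SenderStrategy (Fin 2))
    (ρ : ReceiverAlgorithm (Fin 2) (Fin 4)) (T : ℕ) (v : ℝ) :
    v * (exampleGame.probPayoffGE σ ρ T v).toReal ≤ exampleGame.expectedPayoff σ ρ T := by
  have hm1 : Measurable fun ω => (playLaw σ ρ ω T).toOuterMeasure
      {h | v ≤ exampleGame.averagePayoff h} :=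
    measurable_of_eq_on_initial T _ fun ω ω' h => by rw [playLaw_congr _ _ h]
  have hm2 : Measurable fun ω => ∑' h, (playLaw σ ρ ω T h).toReal * exampleGame.averagePayoff h :=
    measurable_of_eq_on_initial T _ fun ω ω' h => by rw [playLaw_congr _ _ h]
  have hle (ω : ℕ → Fin 2) : (playLaw σ ρ ω T).toOuterMeasure
      {h | v ≤ exampleGame.averagePayoff h} ≤ 1 :=
    le_self_add.trans_eq (toOuterMeasure_add_compl _ _)
  rw [Game.probPayoffGE, ← integral_toReal hm1.aemeasurable
    (ae_of_all _ fun ω => (hle ω).trans_lt ENNReal.one_lt_top), ← integral_const_mul]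
  refine integral_mono ((integrable_of_abs_le hm1.ennreal_toReal 1 fun ω => ?_).const_mul v)
    (integrable_of_abs_le hm2 4 fun ω => ?_) fun ω =>
    mul_toOuterMeasure_le_tsum_toReal_mul _ _ averagePayoff_nonneg averagePayoff_le
  · rw [abs_of_nonneg ENNReal.toReal_nonneg]
    exact ENNReal.toReal_le_of_le_ofReal zero_le_one (by simpa using hle ω)
  · rw [abs_of_nonneg (tsum_toReal_mul_nonneg _ _ averagePayoff_nonneg)]
    exact tsum_toReal_mul_le _ _ averagePayoff_nonneg averagePayoff_le

lemma example_senderGuarantees : exampleGame.SenderGuarantees (28 / 11) := by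
  refine ⟨exampleStrategy, fun ρ hρ ε hε => ⟨?_, tendsto_probPayoffGE hρ hε⟩⟩
  -- The probability for `ε / 2` tends to 1, so its product with 28/11 - ε/2 eventually exceeds
  -- 28/11 - ε.
  have hlim := (ENNReal.tendsto_toReal ENNReal.one_ne_top).comp
    (tendsto_probPayoffGE hρ (half_pos hε))
  have hlim2 := hlim.const_mul (28 / 11 - ε / 2)
  rw [ENNReal.toReal_one, mul_one] at hlim2
  filter_upwards [hlim2.eventually_const_le (show 28 / 11 - ε < 28 / 11 - ε / 2 by linarith)]
    with T hT
  exact hT.trans (mul_probPayoffGE_le_expectedPayoff _ _ _ _)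

end ExampleStrategy

end Forecasting

end

open Forecasting in
theorem theorem3 :
    exampleGame.IsDistributionOfConditionals exampleConditionals ∧
    exampleGame.IsPersuasionValue exampleConditionals 2 ∧
    exampleGame.SenderGuarantees (28 / 11) ∧
    (2 : ℝ) < 28 / 11 :=
  ⟨example_isDistributionOfConditionals, example_isPersuasionValue, example_senderGuarantees,
    by norm_num⟩
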